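/- **Conventions.** A growth function is a continuous nondecreasing map $\Phi$ of $[0,\infty)$ onto itself. Let $\mathscr U$ be the set of convex growth functions $\Phi$, of class $C^1$ on $(0,\infty)$, such that $t\mapsto\Phi(t)/t$ is nondecreasing on $(0,\infty)$ and such that, for some $q\ge 1$ and $C>0$, $\Phi(st)\le C t^q\Phi(s)$ for all $t\ge 1$, $s>0$. Let $\mathscr L$ be the set of concave growth functions $\Phi$, of class $C^1$ on $(0,\infty)$, such that $t\mapsto\Phi(t)/t$ is nonincreasing on $(0,\infty)$ and such that, for some $0<p\le 1$ and $C>0$, $\Phi(st)\le C t^p\Phi(s)$ for all $0<t\le 1$, $s>0$. Elements of $\mathscr L\cup\mathscr U$ are homeomorphisms of $[0,\infty)$; $\Phi^{-1}$ denotes the inverse, and $a_\Phi:=\inf_{t>0}\frac{t\Phi'(t)}{\Phi(t)}$. Let $\mathbb C_+=\{x+iy: y>0\}$. For a bounded interval $I\subset\mathbb R$ of length $|I|>0$ put $Q_I=\{x+iy\in\mathbb C_+: x\in I,\ 0<y<|I|\}$. For $\alpha>-1$, a positive Borel measure $\mu$ on $\mathbb C_+$ is an $(\alpha,\Phi)$-Carleson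 measure if there is $C>0$ with $\mu(Q_I)\le C/\Phi(|I|^{-(2+\alpha)})$ for all such $I$. Finally, with $dV_\alpha(x+iy)=y^\alpha\,dx\,dy$, the Bergman–Orlicz space $A^\Phi_\alpha(\mathbb C_+)$ is the set of analytic functions $F$ on $\mathbb C_+$ with $$\|F\|_{A^\Phi_\alpha}:=\inf\Big\{\lambda>0:\int_{\mathbb C_+}\Phi\big(|F|/\lambda\big)\,dV_\alpha\le 1\Big\}<\infty .$$ **Theorem 2.3.** Let $\alpha>-1$, let $\Phi_1,\Phi_2\in\mathscr L\cup\mathscr U$ and let $\mu$ be a positive Borel measure on $\mathbb C_+$. If $t\mapsto\Phi_2(t)/\Phi_1(t)$ is nondecreasing on $(0,\infty)$, then the following assertions are equivalent. (i) $\mu$ is an $(\alpha,\Phi_2\circ\Phi_1^{-1})$-Carleson measure. (ii) There exist $\rho\in\{1,a_{\Phi_1}\}$ and $C_1>0$ such that for all $z=x+iy\in\mathbb C_+$ $$\int_{\mathbb C_+}\Phi_2\left(\Phi_1^{-1}\Big(\frac1{y^{2+\alpha}}\Big)\frac{y^{(4+2\alpha)/\rho}}{|\omega-\overline z|^{(4+2\alpha)/\rho}}\right)d\mu(\omega)\le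 C_1 .$$ (iii) There exists $C_2>0$ such that for all $F\in A^{\Phi_1}_\alpha(\mathbb C_+)$ with $F\not\equiv0$ $$\int_{\mathbb C_+}\Phi_2\left(\frac{|F(z)|}{\|F\|_{A^{\Phi_1}_\alpha}}\right)d\mu(z)\le C_2 .$$ (iv) There exists $C_3>0$ such that for all $F\in A^{\Phi_1}_\alpha(\mathbb C_+)$ $$\sup_{\lambda>0}\Phi_2(\lambda)\,\mu\big(\{z\in\mathbb C_+:|F(z)|>\lambda\|F\|_{A^{\Phi_1}_\alpha}\}\big)\le C_3 .$$ -/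

import Mathlib

open MeasureTheory Set
open scoped UpperHalfPlane Manifold ENNReal

noncomputable section

namespace BergmanOrlicz

/-- A growth function: a continuous nondecreasing map of `[0, ∞)` onto itself. It is modelled by a
function `Φ : ℝ → ℝ` whose values outside `[0, ∞)` play no role. -/
structure IsGrowth (Φ : ℝ → ℝ) : Prop where
  continuousOn : ContinuousOn Φ (Ici 0)
  monotoneOn : MonotoneOn Φ (Ici 0)
  image_eq : Φ '' Ici 0 = Ici 0

/-- `Φ` is of upper type `q`: `Φ (s t) ≤ C t ^ q Φ s` for all `t ≥ 1` and `s > 0`. -/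
def IsUpperType (q : ℝ) (Φ : ℝ → ℝ) : Prop :=
  ∃ C : ℝ, 0 < C ∧ ∀ t : ℝ, 1 ≤ t → ∀ s : ℝ, 0 < s → Φ (s * t) ≤ C * t ^ q * Φ s

/-- `Φ` is of lower type `p`: `Φ (s t) ≤ C t ^ p Φ s` for all `0 < t ≤ 1` and `s > 0`. -/
def IsLowerType (p : ℝ) (Φ : ℝ → ℝ) : Prop :=
  ∃ C : ℝ, 0 < C ∧ ∀ t : ℝ, 0 < t → t ≤ 1 → ∀ s : ℝ, 0 < s → Φ (s * t) ≤ C * t ^ p * Φ s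

/-- The class `𝓤`: convex growth functions, `C¹` on `(0, ∞)`, of some upper type `q ≥ 1`, with
`t ↦ Φ t / t` nondecreasing on `(0, ∞)`. -/
structure ClassU (Φ : ℝ → ℝ) : Prop where
  growth : IsGrowth Φ
  upperType : ∃ q : ℝ, 1 ≤ q ∧ IsUpperType q Φ
  monotoneOn_div : MonotoneOn (fun t => Φ t / t) (Ioi 0)
  contDiffOn : ContDiffOn ℝ 1 Φ (Ioi 0)
  convexOn : ConvexOn ℝ (Ici 0) Φ

/-- The class `𝓛`: concave growth functions, `C¹` on `(0, ∞)`, of some lower type `0 < p ≤ 1`, with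
`t ↦ Φ t / t` nonincreasing on `(0, ∞)`. -/
structure ClassL (Φ : ℝ → ℝ) : Prop where
  growth : IsGrowth Φ
  lowerType : ∃ p : ℝ, 0 < p ∧ p ≤ 1 ∧ IsLowerType p Φ
  antitoneOn_div : AntitoneOn (fun t => Φ t / t) (Ioi 0)
  contDiffOn : ContDiffOn ℝ 1 Φ (Ioi 0)
  concaveOn : ConcaveOn ℝ (Ici 0) Φ

/-- The inverse `Φ⁻¹ : [0, ∞) → [0, ∞)` of a one-to-one growth function. -/
def inv (Φ : ℝ → ℝ) : ℝ → ℝ := Function.invFunOn Φ (Ici 0)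

/-- The lower index `a_Φ = inf_{t > 0} t Φ'(t) / Φ(t)`. -/
def lowerIndex (Φ : ℝ → ℝ) : ℝ := ⨅ t : Ioi (0 : ℝ), (t : ℝ) * deriv Φ t / Φ t

/-- The Carleson square `Q_I = {x + i y : x ∈ I, 0 < y < |I|}`. -/
def carlesonSquare (I : Set ℝ) : Set ℍ := {z | z.re ∈ I ∧ z.im < volume.real I}

/-- `μ` is an `(s, Φ)`-Carleson measure: `μ (Q_I) ≤ C / Φ (1 / |I| ^ s)` for every interval `I` of
nonzero finite length (open, closed or half-open). -/
def IsSCarleson (s : ℝ) (Φ : ℝ → ℝ) (μ : Measure ℍ) : Prop :=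
  ∃ C : ℝ, 0 < C ∧ ∀ I : Set ℝ, I.OrdConnected → Bornology.IsBounded I → 0 < volume.real I →
    μ (carlesonSquare I) ≤ ENNReal.ofReal (C / Φ (1 / volume.real I ^ s))

/-- An `(α, Φ)`-Carleson measure is a `(2 + α, Φ)`-Carleson measure in the sense above. -/
def IsCarleson (α : ℝ) (Φ : ℝ → ℝ) (μ : Measure ℍ) : Prop := IsSCarleson (2 + α) Φ μ

/-- The measure `dV_α (x + i y) = y ^ α dx dy` on the upper half-plane. (Mathlib's `volume` on `ℍ`
is the hyperbolic measure, so Lebesgue measure is pulled back from `ℂ` here.) -/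
def V (α : ℝ) : Measure ℍ :=
  ((volume : Measure ℂ).comap UpperHalfPlane.coe).withDensity fun z => ENNReal.ofReal (z.im ^ α)

/-- The Luxemburg (quasi-)norm `inf {r > 0 : ∫ Φ (|F| / r) dV_α ≤ 1}`, with `inf ∅ = ∞`. -/
def luxNorm (α : ℝ) (Φ : ℝ → ℝ) (F : ℍ → ℂ) : ℝ≥0∞ :=
  ⨅ (r : ℝ) (_ : 0 < r ∧ ∫⁻ z, ENNReal.ofReal (Φ (‖F z‖ / r)) ∂(V α) ≤ 1), ENNReal.ofReal r

/-- The Bergman–Orlicz space `A_α^Φ(ℂ₊)`: holomorphic functions of finite Luxemburg norm. -/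
def bergmanOrlicz (α : ℝ) (Φ : ℝ → ℝ) : Set (ℍ → ℂ) :=
  {F | MDifferentiable 𝓘(ℂ) 𝓘(ℂ) F ∧ luxNorm α Φ F < ∞}

end BergmanOrlicz

end

/-!
The order of magnitude at `z` of the largest value of `|F|` over the unit ball of `A_α^{Φ₁}` is
`Φ₁⁻¹ (1 / y ^ (2 + α))`, where `y = Im z`.

It is an upper bound because `Φ₁ (|F|)` has, up to a constant, the sub-mean-value property on the
Euclidean disc of centre `z` and radius `y / 2`. Writing
`Φ₂ (|F z|) = (Φ₂ / Φ₁) (|F z|) * Φ₁ (|F z|)`, bounding the monotone quotient by its value at this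
maximal size and `Φ₁ (|F z|)` by its mean over the disc, and integrating with respect to `μ`, one
is left by Tonelli's theorem with the `μ`-measures of the sets of points `z` whose disc contains a
given `w`. These sets lie in Carleson squares of side comparable to `Im w`.

It is attained, up to a constant, by multiples of high powers of `y / (w - z̄)`: the lower type of
`Φ₁` puts them in a fixed ball of `A_α^{Φ₁}`. Their moduli are comparable to the maximal size
throughout the Carleson square of side `y` below `z`, so testing the strong or the weak type
inequality on them returns the Carleson condition.
-/

namespace BergmanOrlicz

/-! ### Growth functions -/

/-- A growth function of some upper type, equivalently one with `Φ (2 s) ≤ C Φ s`: the regularity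
demanded of `Φ₂`. -/
structure IsDoublingGrowth (Φ : ℝ → ℝ) : Prop extends IsGrowth Φ where
  upperType : ∃ q, IsUpperType q Φ

/-- A growth function of some upper type and of lower type `p > 0`: the regularity demanded of `Φ₁`.
It need not be injective, in which case `inv Φ` is just some right inverse of `Φ`. -/
structure IsRegularGrowth (p : ℝ) (Φ : ℝ → ℝ) : Prop extends IsDoublingGrowth Φ where
  exponent_pos : 0 < p
  lowerType : IsLowerType p Φ

section Growth

variable {Φ : ℝ → ℝ} {p : ℝ}

namespace IsGrowth

lemma map_nonneg (h : IsGrowth Φ) {t : ℝ} (ht : 0 ≤ t) : 0 ≤ Φ t := by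
  have : Φ t ∈ Φ '' Ici 0 := mem_image_of_mem Φ ht
  rwa [h.image_eq] at this

lemma map_le_map (h : IsGrowth Φ) {s t : ℝ} (hs : 0 ≤ s) (hst : s ≤ t) : Φ s ≤ Φ t :=
  h.monotoneOn hs (hs.trans hst) hst

lemma mem_image (h : IsGrowth Φ) {u : ℝ} (hu : 0 ≤ u) : u ∈ Φ '' Ici 0 := by
  rwa [h.image_eq]

lemma map_zero (h : IsGrowth Φ) : Φ 0 = 0 := by
  obtain ⟨x, hx, hx0⟩ := h.mem_image le_rfl
  exact le_antisymm ((h.map_le_map le_rfl hx).trans_eq hx0) (h.map_nonneg le_rfl)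

lemma inv_mem (h : IsGrowth Φ) {u : ℝ} (hu : 0 ≤ u) : 0 ≤ inv Φ u :=
  Function.invFunOn_mem (h.mem_image hu)

lemma map_inv (h : IsGrowth Φ) {u : ℝ} (hu : 0 ≤ u) : Φ (inv Φ u) = u :=
  Function.invFunOn_eq (h.mem_image hu)

protected lemma inv_pos (h : IsGrowth Φ) {u : ℝ} (hu : 0 < u) : 0 < inv Φ u := by
  refine (h.inv_mem hu.le).lt_of_ne' fun h0 => hu.ne ?_
  rw [← h.map_inv hu.le, h0, h.map_zero]

lemma inv_monotoneOn (h : IsGrowth Φ) : MonotoneOn (inv Φ) (Ici 0) := by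
  intro u hu v hv huv
  rcases huv.eq_or_lt with rfl | huv
  · rfl
  · by_contra! hlt
    have := h.map_le_map (h.inv_mem hv) hlt.le
    rw [h.map_inv hu, h.map_inv hv] at this
    exact this.not_gt huv

lemma measurable_comp (h : IsGrowth Φ) {X : Type*} [MeasurableSpace X] {f : X → ℝ}
    (hf : Measurable f) (hf0 : ∀ x, 0 ≤ f x) : Measurable fun x => Φ (f x) := by
  have hc : Continuous fun t => Φ (max t 0) :=
    h.continuousOn.comp_continuous (by fun_prop) fun _ => mem_Ici.2 (le_max_right _ _)
  simpa only [Function.comp_def, max_eq_left (hf0 _)] using hc.measurable.comp hf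

lemma map_mul_measure_le_lintegral (h : IsGrowth Φ) {X : Type*} [MeasurableSpace X]
    (μ : Measure X) {f : X → ℝ} (hf : Measurable f) (hf0 : ∀ x, 0 ≤ f x) {t : ℝ} (ht : 0 ≤ t) :
    ENNReal.ofReal (Φ t) * μ {x | t ≤ f x} ≤ ∫⁻ x, ENNReal.ofReal (Φ (f x)) ∂μ :=
  calc _ ≤ ENNReal.ofReal (Φ t) * μ {x | ENNReal.ofReal (Φ t) ≤ ENNReal.ofReal (Φ (f x))} := by
        gcongr with x
        exact fun hx => ENNReal.ofReal_le_ofReal (h.map_le_map ht hx)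
    _ ≤ _ := mul_meas_ge_le_lintegral (h.measurable_comp hf hf0).ennreal_ofReal _

lemma measurable_inv_comp (h : IsGrowth Φ) {X : Type*} [MeasurableSpace X] {f : X → ℝ}
    (hf : Measurable f) (hf0 : ∀ x, 0 ≤ f x) : Measurable fun x => inv Φ (f x) := by
  have hm : Monotone fun u => inv Φ (max u 0) := fun u v huv =>
    h.inv_monotoneOn (mem_Ici.2 (le_max_right _ _)) (mem_Ici.2 (le_max_right _ _))
      (max_le_max_right 0 huv)
  simpa only [Function.comp_def, max_eq_left (hf0 _)] using hm.measurable.comp hf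

end IsGrowth

namespace IsDoublingGrowth

lemma map_pos (h : IsDoublingGrowth Φ) {s : ℝ} (hs : 0 < s) : 0 < Φ s := by
  obtain ⟨q, C, -, hC⟩ := h.upperType
  obtain ⟨t, ht, ht1⟩ := h.mem_image zero_le_one
  refine (h.map_nonneg hs.le).lt_of_ne' fun hs0 => ?_
  have h1 : Φ t ≤ Φ (s * max (t / s) 1) := by
    refine h.map_le_map ht ?_
    rw [← div_le_iff₀' hs]
    exact le_max_left _ _
  have h2 := hC _ (le_max_right (t / s) 1) s hs
  rw [hs0, mul_zero] at h2
  linarith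

lemma exists_map_mul_le (h : IsDoublingGrowth Φ) {K : ℝ} (hK : 0 ≤ K) :
    ∃ C, 0 < C ∧ ∀ s, 0 ≤ s → Φ (K * s) ≤ C * Φ s := by
  obtain ⟨q, C, hC0, hC⟩ := h.upperType
  have : 0 < max K 1 := lt_max_of_lt_right one_pos
  refine ⟨C * max K 1 ^ q, by positivity, fun s hs => ?_⟩
  rcases hs.eq_or_lt with rfl | hs
  · simp [h.map_zero]
  calc Φ (K * s) ≤ Φ (s * max K 1) := by
        refine h.map_le_map (by positivity) ?_
        rw [mul_comm]
        gcongr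
        exact le_max_left _ _
    _ ≤ C * max K 1 ^ q * Φ s := hC _ (le_max_right _ _) s hs

end IsDoublingGrowth

namespace IsRegularGrowth

lemma exists_le_mul_of_map_le (h : IsRegularGrowth p Φ) (K : ℝ) :
    ∃ L, 1 ≤ L ∧ ∀ s t, 0 < t → Φ s ≤ K * Φ t → s ≤ L * t := by
  obtain ⟨C, hC0, hC⟩ := h.lowerType
  refine ⟨max 1 ((C * K) ^ p⁻¹), le_max_left _ _, fun s t ht hst => ?_⟩
  rw [← div_le_iff₀ ht, le_max_iff]
  refine (le_or_gt (s / t) 1).imp_right fun hts => ?_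
  have hs : 0 < s := ht.trans ((one_lt_div ht).1 hts)
  have hΦ : Φ t ≤ C * (t / s) ^ p * (K * Φ t) := by
    have := hC (t / s) (by positivity) (by rw [← inv_div]; exact inv_le_one_of_one_le₀ hts.le) s hs
    rw [mul_div_cancel₀ t hs.ne'] at this
    exact this.trans (by gcongr)
  have hpow : (s / t) ^ p ≤ C * K := by
    rw [← inv_div s t, Real.inv_rpow (by positivity), ← div_eq_mul_inv, ← mul_assoc,
      div_mul_eq_mul_div] at hΦ
    have := (le_mul_iff_one_le_left (h.map_pos ht)).1 hΦ
    rwa [one_le_div (by positivity)] at this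
  have hCK : 0 ≤ C * K := (by positivity : 0 ≤ (s / t) ^ p).trans hpow
  exact (Real.le_rpow_inv_iff_of_pos (by positivity) hCK h.exponent_pos).2 hpow

lemma exists_inv_mul_le (h : IsRegularGrowth p Φ) {K : ℝ} (hK : 0 ≤ K) :
    ∃ L, 1 ≤ L ∧ ∀ u, 0 < u → inv Φ (K * u) ≤ L * inv Φ u := by
  obtain ⟨L, hL, hL'⟩ := h.exists_le_mul_of_map_le K
  refine ⟨L, hL, fun u hu => hL' _ _ (h.inv_pos hu) ?_⟩
  rw [h.map_inv hu.le, h.map_inv (by positivity)]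

end IsRegularGrowth

end Growth

/-! ### The classes `𝓛` and `𝓤` -/

section Classes

variable {Φ : ℝ → ℝ} {a : ℝ}

lemma ClassU.isDoublingGrowth (h : ClassU Φ) : IsDoublingGrowth Φ :=
  ⟨h.growth, h.upperType.imp fun _ => And.right⟩

lemma ClassL.isUpperType_one (h : ClassL Φ) : IsUpperType 1 Φ := by
  refine ⟨1, one_pos, fun t ht s hs => ?_⟩
  have hst : 0 < s * t := by positivity
  have := h.antitoneOn_div hs hst (le_mul_of_one_le_right hs.le ht)
  rw [div_le_div_iff₀ hst hs] at this
  rw [one_mul, Real.rpow_one]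
  exact le_of_mul_le_mul_right (this.trans_eq (by ring)) hs

lemma ClassL.isDoublingGrowth (h : ClassL Φ) : IsDoublingGrowth Φ :=
  ⟨h.growth, 1, h.isUpperType_one⟩

lemma ClassU.map_le_mul_deriv (h : ClassU Φ) {t : ℝ} (ht : 0 < t) : Φ t ≤ t * deriv Φ t := by
  have hd : DifferentiableAt ℝ Φ t :=
    (h.contDiffOn.differentiableOn one_ne_zero).differentiableAt (Ioi_mem_nhds ht)
  have := h.convexOn.slope_le_deriv self_mem_Ici ht.le ht hd
  rwa [slope_def_field, h.growth.map_zero, sub_zero, sub_zero, div_le_iff₀' ht] at this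

lemma ClassL.exists_mul_map_le_mul_deriv (h : ClassL Φ) :
    ∃ c, 0 < c ∧ ∀ t, 0 < t → c * Φ t ≤ t * deriv Φ t := by
  obtain ⟨p, hp, -, hlower⟩ := h.lowerType
  have hreg : IsRegularGrowth p Φ := ⟨h.isDoublingGrowth, hp, hlower⟩
  obtain ⟨L, hL, hL'⟩ := hreg.exists_le_mul_of_map_le 2
  have hL0 : 0 < L := one_pos.trans_le hL
  refine ⟨L⁻¹, inv_pos.2 hL0, fun t ht => ?_⟩
  have htL : t < (L + 1) * t := by nlinarith
  have hdouble : 2 * Φ t < Φ ((L + 1) * t) := by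
    by_contra! hle
    nlinarith [hL' _ t ht hle]
  have hd : DifferentiableAt ℝ Φ t :=
    (h.contDiffOn.differentiableOn one_ne_zero).differentiableAt (Ioi_mem_nhds ht)
  have hslope := h.concaveOn.slope_le_deriv ht.le (ht.trans htL).le htL hd
  rw [slope_def_field, add_one_mul, add_sub_cancel_right, div_le_iff₀ (by positivity)] at hslope
  rw [add_one_mul] at hdouble
  rw [inv_mul_le_iff₀ hL0]
  linarith

lemma le_lowerIndex {c : ℝ} (hpos : ∀ t, 0 < t → 0 < Φ t)
    (hc : ∀ t, 0 < t → c * Φ t ≤ t * deriv Φ t) : c ≤ lowerIndex Φ := by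
  have : Nonempty (Ioi (0 : ℝ)) := ⟨⟨1, mem_Ioi.2 one_pos⟩⟩
  exact le_ciInf fun t => (le_div_iff₀ (hpos _ t.2)).2 (hc _ t.2)

lemma lowerIndex_mul_map_le (hpos : ∀ t, 0 < t → 0 < Φ t)
    (hderiv : ∀ t, 0 < t → 0 ≤ deriv Φ t) {t : ℝ} (ht : 0 < t) :
    lowerIndex Φ * Φ t ≤ t * deriv Φ t := by
  rw [← le_div_iff₀ (hpos t ht)]
  refine ciInf_le ⟨0, ?_⟩ (⟨t, ht⟩ : Ioi (0 : ℝ))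
  rintro _ ⟨⟨s, hs⟩, rfl⟩
  exact div_nonneg (mul_nonneg (le_of_lt hs) (hderiv s hs)) (hpos s hs).le

lemma monotoneOn_mul_rpow_neg (hdiff : DifferentiableOn ℝ Φ (Ioi 0))
    (ha : ∀ t, 0 < t → a * Φ t ≤ t * deriv Φ t) :
    MonotoneOn (fun t => Φ t * t ^ (-a)) (Ioi 0) := by
  have hder : ∀ x ∈ Ioi (0 : ℝ), HasDerivAt (fun t => Φ t * t ^ (-a))
      (deriv Φ x * x ^ (-a) + Φ x * (-a * x ^ (-a - 1))) x := fun x hx =>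
    (hdiff.differentiableAt (Ioi_mem_nhds hx)).hasDerivAt.mul
      (Real.hasDerivAt_rpow_const (Or.inl (ne_of_gt hx)))
  refine monotoneOn_of_deriv_nonneg (convex_Ioi 0)
    (fun x hx => (hder x hx).continuousAt.continuousWithinAt)
    (fun x hx => (hder x (interior_subset hx)).differentiableAt.differentiableWithinAt) ?_
  rw [interior_Ioi]
  intro x hx
  have hx0 : 0 < x := hx
  calc 0 ≤ x ^ (-a) / x * (x * deriv Φ x - a * Φ x) :=
        mul_nonneg (by positivity) (sub_nonneg.2 (ha x hx0))
    _ = deriv (fun t => Φ t * t ^ (-a)) x := by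
        rw [(hder x hx).deriv, Real.rpow_sub_one hx0.ne']
        field_simp
        ring

lemma isLowerType_of_mul_le_mul_deriv (hdiff : DifferentiableOn ℝ Φ (Ioi 0))
    (ha : ∀ t, 0 < t → a * Φ t ≤ t * deriv Φ t) : IsLowerType a Φ := by
  refine ⟨1, one_pos, fun t ht ht1 s hs => ?_⟩
  have hst : 0 < s * t := mul_pos hs ht
  have hmono := monotoneOn_mul_rpow_neg hdiff ha hst hs (mul_le_of_le_one_right hs.le ht1)
  simp only [Real.rpow_neg hst.le, Real.rpow_neg hs.le, ← div_eq_mul_inv,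
    Real.mul_rpow hs.le ht.le] at hmono
  rw [div_le_div_iff₀ (by positivity) (by positivity)] at hmono
  exact le_of_mul_le_mul_right (hmono.trans_eq (by ring)) (by positivity : 0 < s ^ a)

lemma IsDoublingGrowth.isRegularGrowth_lowerIndex (h : IsDoublingGrowth Φ)
    (hdiff : DifferentiableOn ℝ Φ (Ioi 0))
    (hc : ∃ c, 0 < c ∧ ∀ t, 0 < t → c * Φ t ≤ t * deriv Φ t) :
    IsRegularGrowth (lowerIndex Φ) Φ := by
  obtain ⟨c, hc0, hc⟩ := hc
  have hpos : ∀ t, 0 < t → 0 < Φ t := fun t => h.map_pos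
  have hderiv : ∀ t, 0 < t → 0 ≤ deriv Φ t := fun t ht =>
    le_of_mul_le_mul_left
      ((mul_zero t).trans_le ((mul_pos hc0 (hpos t ht)).le.trans (hc t ht))) ht
  exact ⟨h, hc0.trans_le (le_lowerIndex hpos hc),
    isLowerType_of_mul_le_mul_deriv hdiff fun t => lowerIndex_mul_map_le hpos hderiv⟩

lemma isRegularGrowth_lowerIndex_of_classL_or_classU (h : ClassL Φ ∨ ClassU Φ) :
    IsRegularGrowth (lowerIndex Φ) Φ := by
  rcases h with h | h
  · exact h.isDoublingGrowth.isRegularGrowth_lowerIndex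
      (h.contDiffOn.differentiableOn one_ne_zero) h.exists_mul_map_le_mul_deriv
  · exact h.isDoublingGrowth.isRegularGrowth_lowerIndex
      (h.contDiffOn.differentiableOn one_ne_zero)
      ⟨1, one_pos, fun t ht => (one_mul (Φ t)).trans_le (h.map_le_mul_deriv ht)⟩

end Classes

/-! ### Sub-mean value inequalities -/

section SubMeanValue

open Metric

variable {f : ℂ → ℂ} {c : ℂ} {R : ℝ}

lemma two_pi_mul_enorm_le_lintegral_circleMap (hR : 0 ≤ R) (hf : DiffContOnCl ℂ f (ball c R)) :
    ENNReal.ofReal (2 * Real.pi) * ‖f c‖ₑ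
      ≤ ∫⁻ θ in Ioo (-Real.pi) Real.pi, ‖f (circleMap c R θ)‖ₑ := by
  have hav : Real.circleAverage f c R = f c :=
    DiffContOnCl.circleAverage (by rwa [abs_of_nonneg hR])
  rw [Real.circleAverage_eq_integral_add (-Real.pi),
    intervalIntegral.integral_comp_add_right (fun θ => f (circleMap c R θ))] at hav
  have hint : ∫ θ in Ioo (-Real.pi) Real.pi, f (circleMap c R θ) = (2 * Real.pi) • f c := by
    rw [← hav, smul_smul, mul_inv_cancel₀ (by positivity), one_smul,
      show (0 : ℝ) + -Real.pi = -Real.pi by ring, show 2 * Real.pi + -Real.pi = Real.pi by ring,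
      intervalIntegral.integral_of_le (by linarith [Real.pi_pos]), integral_Ioc_eq_integral_Ioo]
  calc ENNReal.ofReal (2 * Real.pi) * ‖f c‖ₑ = ‖(2 * Real.pi) • f c‖ₑ := by
        rw [enorm_smul, Real.enorm_of_nonneg (by positivity)]
    _ ≤ _ := by rw [← hint]; exact enorm_integral_le_lintegral_enorm _

lemma setLIntegral_Ioo_ofReal (hR : 0 ≤ R) :
    ∫⁻ r in Ioo 0 R, ENNReal.ofReal r = ENNReal.ofReal (R ^ 2 / 2) := by
  rw [← ofReal_integral_eq_lintegral_ofReal, ← integral_Ioc_eq_integral_Ioo,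
    ← intervalIntegral.integral_of_le hR, integral_id]
  · simp
  · exact (continuous_id.integrableOn_Icc (a := 0) (b := R)).mono_set Ioo_subset_Icc_self
  · exact (ae_restrict_mem measurableSet_Ioo).mono fun r hr => hr.1.le

lemma lintegral_circleMap_le_setLIntegral_ball {g : ℂ → ℝ≥0∞}
    (hg : Measurable ((ball c R).indicator g)) :
    ∫⁻ r in Ioo 0 R, ENNReal.ofReal r * ∫⁻ θ in Ioo (-Real.pi) Real.pi, g (circleMap c r θ)
      ≤ ∫⁻ w in ball c R, g w := by
  have hpolar : ∀ r θ, c + Complex.polarCoord.symm (r, θ) = circleMap c r θ := fun r θ => by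
    rw [Complex.polarCoord_symm_apply, circleMap, Complex.exp_mul_I]
    push_cast
    ring
  have hmeas : Measurable fun q : ℝ × ℝ =>
      ENNReal.ofReal q.1 • (ball c R).indicator g (c + Complex.polarCoord.symm q) := by
    simp only [Complex.polarCoord_symm_apply, smul_eq_mul]
    exact Measurable.mul (by fun_prop) (hg.comp (by fun_prop))
  rw [← lintegral_indicator measurableSet_ball, ← lintegral_add_left_eq_self _ c,
    ← Complex.lintegral_comp_polarCoord_symm, polarCoord_target, Measure.volume_eq_prod,
    ← Measure.prod_restrict, lintegral_prod _ hmeas.aemeasurable]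
  refine le_trans (setLIntegral_mono' measurableSet_Ioo fun r hr => ?_)
    (lintegral_mono_set Ioo_subset_Ioi_self)
  simp only [smul_eq_mul, hpolar]
  rw [lintegral_const_mul' _ _ ENNReal.ofReal_ne_top]
  refine le_of_eq ?_
  congr 1
  refine lintegral_congr fun θ => (indicator_of_mem ?_ g).symm
  simpa [dist_eq_norm, abs_of_pos hr.1] using hr.2

lemma area_mul_enorm_le_setLIntegral_ball (hR : 0 ≤ R) (hf : DiffContOnCl ℂ f (ball c R)) :
    ENNReal.ofReal (Real.pi * R ^ 2) * ‖f c‖ₑ ≤ ∫⁻ w in ball c R, ‖f w‖ₑ := by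
  have hmeas : Measurable ((ball c R).indicator fun w => ‖f w‖ₑ) := by
    classical
    rw [← piecewise_eq_indicator]
    exact hf.1.continuousOn.enorm.measurable_piecewise continuousOn_const measurableSet_ball
  calc ENNReal.ofReal (Real.pi * R ^ 2) * ‖f c‖ₑ
      = ∫⁻ r in Ioo 0 R, ENNReal.ofReal r * (ENNReal.ofReal (2 * Real.pi) * ‖f c‖ₑ) := by
        rw [lintegral_mul_const _ (by fun_prop), setLIntegral_Ioo_ofReal hR, ← mul_assoc,
          ← ENNReal.ofReal_mul (by positivity)]
        congr 2
        ring
    _ ≤ ∫⁻ r in Ioo 0 R, ENNReal.ofReal r *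
          ∫⁻ θ in Ioo (-Real.pi) Real.pi, ‖f (circleMap c r θ)‖ₑ :=
        setLIntegral_mono' measurableSet_Ioo fun r hr => mul_le_mul_right
          (two_pi_mul_enorm_le_lintegral_circleMap hr.1.le (hf.mono (ball_subset_ball hr.2.le))) _
    _ ≤ ∫⁻ w in ball c R, ‖f w‖ₑ := lintegral_circleMap_le_setLIntegral_ball hmeas

/-- Hardy–Littlewood's choice of a point: maximize `(R - dist u c) ^ n * g u`. -/
lemma exists_ball_subset_ball_forall_le {X : Type*} [PseudoMetricSpace X] [ProperSpace X]
    {g : X → ℝ} {x : X} {n : ℕ} (hn : n ≠ 0) (hR : 0 < R) (hg : ContinuousOn g (closedBall x R))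
    (hg0 : ∀ u, 0 ≤ g u) (hx : 0 < g x) :
    ∃ w d, 0 < d ∧ ball w d ⊆ ball x R ∧ R ^ n * g x ≤ (2 * d) ^ n * g w ∧
      ∀ u ∈ ball w d, g u ≤ 2 ^ n * g w := by
  obtain ⟨w, hw, hmax⟩ := (isCompact_closedBall x R).exists_isMaxOn
    ⟨x, mem_closedBall_self hR.le⟩
    (f := fun u => (R - dist u x) ^ n * g u) (ContinuousOn.mul (by fun_prop) hg)
  have hR_le : R ^ n * g x ≤ (R - dist w x) ^ n * g w := by
    simpa using hmax (mem_closedBall_self hR.le)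
  have hd : 0 < R - dist w x := by
    refine (sub_nonneg.2 hw).lt_of_ne' fun h0 => ?_
    rw [h0, zero_pow hn, zero_mul] at hR_le
    exact hR_le.not_gt (by positivity)
  have hdist : ∀ u ∈ ball w ((R - dist w x) / 2), (R - dist w x) / 2 < R - dist u x := by
    intro u hu
    rw [mem_ball] at hu
    linarith [dist_triangle u w x]
  refine ⟨w, (R - dist w x) / 2, half_pos hd, fun u hu => ?_, ?_, fun u hu => ?_⟩
  · exact sub_pos.1 ((half_pos hd).trans (hdist u hu))
  · rwa [mul_div_cancel₀ _ two_ne_zero]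
  · have hu' := hdist u hu
    have hle : (R - dist u x) ^ n * g u ≤ (R - dist w x) ^ n * g w :=
      hmax (mem_closedBall.2 (by linarith : dist u x ≤ R))
    have hpow : ((R - dist w x) / 2) ^ n * g u ≤ (R - dist u x) ^ n * g u := by
      have := hg0 u
      gcongr
    refine le_of_mul_le_mul_left ((hpow.trans hle).trans_eq ?_) (pow_pos (half_pos hd) n)
    rw [div_pow, ← mul_assoc, div_mul_cancel₀ _ (by positivity)]

variable {Φ : ℝ → ℝ} {p L : ℝ}

lemma IsGrowth.map_half_div_mul_le (h : IsGrowth Φ) {m s : ℝ} (hm : 0 < m) (hs : 0 ≤ s)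
    (hL : s ≤ L * m) : Φ (m / 2) / m * s ≤ Φ (m / 2) / 2 + L * Φ s := by
  have hΦm := h.map_nonneg (half_pos hm).le
  have hΦs := h.map_nonneg hs
  have hL0 : 0 ≤ L := nonneg_of_mul_nonneg_left (hs.trans hL) hm
  rw [div_mul_eq_mul_div, div_le_iff₀ hm]
  rcases le_total s (m / 2) with hsm | hsm
  · nlinarith [mul_le_mul_of_nonneg_left hsm hΦm, mul_nonneg (mul_nonneg hL0 hΦs) hm.le]
  · have hΦ := h.map_le_map (half_pos hm).le hsm
    nlinarith [mul_le_mul hΦ hL hs hΦs, mul_nonneg hΦm hm.le]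

lemma IsGrowth.area_mul_map_half_le (h : IsGrowth Φ) (hR : 0 ≤ R)
    (hf : DiffContOnCl ℂ f (ball c R)) (hc : f c ≠ 0)
    (hL : ∀ u ∈ ball c R, ‖f u‖ ≤ L * ‖f c‖) :
    ENNReal.ofReal (Real.pi * R ^ 2 * (Φ (‖f c‖ / 2) / 2))
      ≤ ENNReal.ofReal L * ∫⁻ u in ball c R, ENNReal.ofReal (Φ ‖f u‖) := by
  have hm : 0 < ‖f c‖ := norm_pos_iff.2 hc
  have hΦ := h.map_nonneg (half_pos hm).le
  have hvol : volume (ball c R) = ENNReal.ofReal (Real.pi * R ^ 2) := by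
    rw [Complex.volume_ball, ENNReal.ofReal_mul' (by positivity), ENNReal.ofReal_pow hR, mul_comm,
      ← NNReal.coe_real_pi, ENNReal.ofReal_coe_nnreal]
  have hpointwise : ∀ u ∈ ball c R, ENNReal.ofReal (Φ (‖f c‖ / 2) / ‖f c‖) * ‖f u‖ₑ
      ≤ ENNReal.ofReal (Φ (‖f c‖ / 2) / 2) + ENNReal.ofReal L * ENNReal.ofReal (Φ ‖f u‖) := by
    intro u hu
    have hΦu := h.map_nonneg (norm_nonneg (f u))
    have hL0 : 0 ≤ L := nonneg_of_mul_nonneg_left ((norm_nonneg _).trans (hL u hu)) hm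
    rw [← ofReal_norm, ← ENNReal.ofReal_mul (by positivity), ← ENNReal.ofReal_mul hL0,
      ← ENNReal.ofReal_add (by positivity) (by positivity)]
    exact ENNReal.ofReal_le_ofReal (h.map_half_div_mul_le hm (norm_nonneg _) (hL u hu))
  have hsum : ENNReal.ofReal (Real.pi * R ^ 2 * (Φ (‖f c‖ / 2) / 2)) +
        ENNReal.ofReal (Real.pi * R ^ 2 * (Φ (‖f c‖ / 2) / 2))
      ≤ ENNReal.ofReal (Real.pi * R ^ 2 * (Φ (‖f c‖ / 2) / 2)) +
        ENNReal.ofReal L * ∫⁻ u in ball c R, ENNReal.ofReal (Φ ‖f u‖) := calc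
    _ = ENNReal.ofReal (Φ (‖f c‖ / 2) / ‖f c‖) *
          (ENNReal.ofReal (Real.pi * R ^ 2) * ‖f c‖ₑ) := by
        rw [← ENNReal.ofReal_add (by positivity) (by positivity), ← ofReal_norm,
          ← ENNReal.ofReal_mul (by positivity), ← ENNReal.ofReal_mul (by positivity)]
        congr 1
        field_simp
        ring
    _ ≤ ENNReal.ofReal (Φ (‖f c‖ / 2) / ‖f c‖) * ∫⁻ u in ball c R, ‖f u‖ₑ :=
        mul_le_mul_right (area_mul_enorm_le_setLIntegral_ball hR hf) _
    _ ≤ ∫⁻ u in ball c R, (ENNReal.ofReal (Φ (‖f c‖ / 2) / 2) +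
          ENNReal.ofReal L * ENNReal.ofReal (Φ ‖f u‖)) := by
        rw [← lintegral_const_mul' _ _ ENNReal.ofReal_ne_top]
        exact setLIntegral_mono' measurableSet_ball hpointwise
    _ = _ := by
        rw [lintegral_add_left measurable_const, setLIntegral_const, hvol, mul_comm,
          lintegral_const_mul' _ _ ENNReal.ofReal_ne_top, ← ENNReal.ofReal_mul (by positivity)]
  exact (ENNReal.add_le_add_iff_left ENNReal.ofReal_ne_top).1 hsum

lemma IsRegularGrowth.exists_sq_mul_map_norm_le (h : IsRegularGrowth p Φ) :
    ∃ C, 0 < C ∧ ∀ (f : ℂ → ℂ) (c : ℂ) (R : ℝ), 0 < R → DiffContOnCl ℂ f (ball c R) →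
      ENNReal.ofReal (R ^ 2 * Φ ‖f c‖)
        ≤ ENNReal.ofReal C * ∫⁻ u in ball c R, ENNReal.ofReal (Φ ‖f u‖) := by
  obtain ⟨D, hD0, hD⟩ := h.exists_map_mul_le zero_le_two
  obtain ⟨L, hL1, hL⟩ := h.exists_le_mul_of_map_le (2 ^ 2)
  have : 0 < L := one_pos.trans_le hL1
  have := Real.pi_pos
  refine ⟨8 * D / Real.pi * L, by positivity, fun f c R hR hf => ?_⟩
  have hfc : ContinuousOn f (closedBall c R) := closure_ball c hR.ne' ▸ hf.2
  have hΦ0 : ∀ u, 0 ≤ Φ ‖f u‖ := fun u => h.map_nonneg (norm_nonneg _)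
  rcases (hΦ0 c).eq_or_lt with hc | hc
  · simp [← hc]
  obtain ⟨w, d, hd, hsub, hR_le, hle⟩ := exists_ball_subset_ball_forall_le two_ne_zero hR
    (h.continuousOn.comp hfc.norm fun u _ => norm_nonneg (f u)) hΦ0 hc
  have hw : f w ≠ 0 := by
    rintro hw
    have : 0 < R ^ 2 * Φ ‖f c‖ := by positivity
    exact this.not_ge (by simpa [hw, h.map_zero] using hR_le)
  have hw0 : 0 < ‖f w‖ := norm_pos_iff.2 hw
  have hhalf : Φ ‖f w‖ ≤ D * Φ (‖f w‖ / 2) := by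
    simpa [mul_div_cancel₀] using hD (‖f w‖ / 2) (by positivity)
  calc ENNReal.ofReal (R ^ 2 * Φ ‖f c‖)
      ≤ ENNReal.ofReal (8 * D / Real.pi * (Real.pi * d ^ 2 * (Φ (‖f w‖ / 2) / 2))) := by
        apply ENNReal.ofReal_le_ofReal
        calc R ^ 2 * Φ ‖f c‖ ≤ (2 * d) ^ 2 * Φ ‖f w‖ := hR_le
          _ ≤ (2 * d) ^ 2 * (D * Φ (‖f w‖ / 2)) := by gcongr
          _ = _ := by field_simp; ring
    _ ≤ ENNReal.ofReal (8 * D / Real.pi) *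
          (ENNReal.ofReal L * ∫⁻ u in ball w d, ENNReal.ofReal (Φ ‖f u‖)) := by
        rw [ENNReal.ofReal_mul (by positivity)]
        gcongr
        exact h.area_mul_map_half_le hd.le (hf.mono hsub) hw fun u hu => hL _ _ hw0 (hle u hu)
    _ ≤ _ := by
        rw [← mul_assoc, ← ENNReal.ofReal_mul (by positivity)]
        gcongr

end SubMeanValue

/-! ### The upper half-plane -/

section HalfPlane

lemma setLIntegral_V_preimage_coe (α : ℝ) {S : Set ℂ} (hS : MeasurableSet S)
    (hS' : S ⊆ {w | 0 < w.im}) (g : ℂ → ℝ≥0∞) :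
    ∫⁻ w in UpperHalfPlane.coe ⁻¹' S, g w ∂(V α)
      = ∫⁻ w in S, ENNReal.ofReal (w.im ^ α) * g w := by
  have he := UpperHalfPlane.measurableEmbedding_coe
  have hm : Measurable fun w : ℍ => ENNReal.ofReal (w.im ^ α) := by
    have : Measurable UpperHalfPlane.im := UpperHalfPlane.continuous_im.measurable
    fun_prop
  rw [V, setLIntegral_withDensity_eq_setLIntegral_mul_non_measurable _ hm _
    (UpperHalfPlane.measurable_coe hS) (.of_forall fun _ => ENNReal.ofReal_lt_top)]
  calc _ = ∫⁻ w in S, ENNReal.ofReal (w.im ^ α) * g w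
        ∂((volume : Measure ℂ).comap UpperHalfPlane.coe).map UpperHalfPlane.coe := by
        rw [he.restrict_map, he.lintegral_map]
        rfl
    _ = _ := by
        rw [he.map_comap, Measure.restrict_restrict hS,
          inter_eq_left.2 (hS'.trans_eq UpperHalfPlane.range_coe.symm)]

lemma rpow_le_two_rpow_abs_mul {x y : ℝ} (hx : 0 < x) (hy : 0 < y) (h1 : x ≤ 2 * y)
    (h2 : y ≤ 2 * x) (β : ℝ) : y ^ β ≤ 2 ^ |β| * x ^ β := by
  rcases le_total 0 β with hβ | hβ
  · rw [abs_of_nonneg hβ, ← Real.mul_rpow two_pos.le hx.le]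
    exact Real.rpow_le_rpow hy.le h2 hβ
  · rw [abs_of_nonpos hβ, Real.rpow_neg two_pos.le, ← Real.inv_rpow two_pos.le,
      ← Real.mul_rpow (by positivity) hx.le]
    exact Real.rpow_le_rpow_of_nonpos (by positivity) (by linarith) hβ

/-- The Whitney disc of `z`: the Euclidean disc of centre `z` and radius `z.im / 2`, on which
`im` is comparable to `z.im`. -/
def whitneyDisc (z : ℍ) : Set ℍ := UpperHalfPlane.coe ⁻¹' Metric.ball (z : ℂ) (z.im / 2)

lemma im_bounds_of_norm_sub_le {z : ℍ} {w : ℂ} (h : ‖w - z‖ ≤ z.im / 2) :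
    z.im / 2 ≤ w.im ∧ w.im ≤ 3 / 2 * z.im := by
  have := (Complex.abs_im_le_norm _).trans h
  rw [Complex.sub_im, UpperHalfPlane.coe_im, abs_le] at this
  constructor <;> linarith

lemma abs_re_sub_re_lt_of_mem_whitneyDisc {z w : ℍ} (h : w ∈ whitneyDisc z) :
    |w.re - z.re| < z.im / 2 := by
  have h0 : ‖(w : ℂ) - z‖ < z.im / 2 := mem_ball_iff_norm.1 h
  simpa using (Complex.abs_re_le_norm _).trans_lt h0

lemma rpow_im_mul_setLIntegral_ball_le (α : ℝ) (z : ℍ) (g : ℂ → ℝ≥0∞) :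
    ENNReal.ofReal (z.im ^ α) * ∫⁻ w in Metric.ball (z : ℂ) (z.im / 2), g w
      ≤ ENNReal.ofReal (2 ^ |α|) * ∫⁻ w in whitneyDisc z, g w ∂(V α) := by
  have hy := z.im_pos
  have him {w : ℂ} (hw : w ∈ Metric.ball (z : ℂ) (z.im / 2)) :=
    im_bounds_of_norm_sub_le (mem_ball_iff_norm.1 hw).le
  have hpos {w : ℂ} (hw : w ∈ Metric.ball (z : ℂ) (z.im / 2)) : 0 < w.im :=
    (half_pos hy).trans_le (him hw).1
  rw [whitneyDisc, setLIntegral_V_preimage_coe α measurableSet_ball fun _ => hpos,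
    ← lintegral_const_mul' _ _ ENNReal.ofReal_ne_top,
    ← lintegral_const_mul' _ _ ENNReal.ofReal_ne_top]
  refine setLIntegral_mono' measurableSet_ball fun w hw => ?_
  rw [← mul_assoc, ← ENNReal.ofReal_mul (p := 2 ^ |α|) (by positivity)]
  gcongr
  obtain ⟨h1, h2⟩ := him hw
  exact rpow_le_two_rpow_abs_mul (hpos hw) hy (by linarith) (by linarith) α

lemma IsRegularGrowth.exists_rpow_mul_map_norm_le {Φ : ℝ → ℝ} {p : ℝ} (h : IsRegularGrowth p Φ)
    (α : ℝ) : ∃ C, 0 < C ∧ ∀ F : ℍ → ℂ, MDifferentiable 𝓘(ℂ) 𝓘(ℂ) F → ∀ z : ℍ,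
      ENNReal.ofReal (z.im ^ (2 + α) * Φ ‖F z‖)
        ≤ ENNReal.ofReal C * ∫⁻ w in whitneyDisc z, ENNReal.ofReal (Φ ‖F w‖) ∂(V α) := by
  obtain ⟨C, hC0, hC⟩ := h.exists_sq_mul_map_norm_le
  refine ⟨4 * C * 2 ^ |α|, by positivity, fun F hF z => ?_⟩
  have hy : 0 < z.im := z.im_pos
  set f : ℂ → ℂ := F ∘ UpperHalfPlane.ofComplex with hf
  have hfF (w : ℍ) : f w = F w := by simp [hf]
  set B := Metric.ball (z : ℂ) (z.im / 2)
  have hfd : DiffContOnCl ℂ f B := by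
    refine DifferentiableOn.diffContOnCl ?_
    rw [closure_ball _ (half_pos hy).ne']
    exact (UpperHalfPlane.mdifferentiable_iff.1 hF).mono fun w hw =>
      (half_pos hy).trans_le (im_bounds_of_norm_sub_le (mem_closedBall_iff_norm.1 hw)).1
  calc ENNReal.ofReal (z.im ^ (2 + α) * Φ ‖F z‖)
      = ENNReal.ofReal (4 * z.im ^ α) * ENNReal.ofReal ((z.im / 2) ^ 2 * Φ ‖f z‖) := by
        rw [← ENNReal.ofReal_mul (by positivity), Real.rpow_add hy, Real.rpow_two, hfF]
        ring_nf
    _ ≤ ENNReal.ofReal (4 * z.im ^ α) *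
          (ENNReal.ofReal C * ∫⁻ w in B, ENNReal.ofReal (Φ ‖f w‖)) := by
        gcongr
        exact hC f z _ (half_pos hy) hfd
    _ = ENNReal.ofReal (4 * C) *
          (ENNReal.ofReal (z.im ^ α) * ∫⁻ w in B, ENNReal.ofReal (Φ ‖f w‖)) := by
        rw [ENNReal.ofReal_mul four_pos.le, ENNReal.ofReal_mul four_pos.le]
        ring
    _ ≤ ENNReal.ofReal (4 * C) * (ENNReal.ofReal (2 ^ |α|) *
          ∫⁻ w in whitneyDisc z, ENNReal.ofReal (Φ ‖f w‖) ∂(V α)) :=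
        mul_le_mul_right (rpow_im_mul_setLIntegral_ball_le α z _) _
    _ = _ := by
        rw [ENNReal.ofReal_mul (q := 2 ^ |α|) (by positivity), mul_assoc]
        simp only [hfF]

end HalfPlane

/-! ### The Luxemburg norm -/

section LuxNorm

/-- The order of magnitude at `z` of the largest `‖F z‖` over the unit ball of the Bergman–Orlicz
space. -/
noncomputable def peak (α : ℝ) (Φ : ℝ → ℝ) (z : ℍ) : ℝ := inv Φ (1 / z.im ^ (2 + α))

variable {Φ : ℝ → ℝ} {p α : ℝ} {F : ℍ → ℂ}

lemma one_div_im_rpow_pos (s : ℝ) (z : ℍ) : 0 < 1 / z.im ^ s :=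
  one_div_pos.2 (Real.rpow_pos_of_pos z.im_pos s)

lemma IsGrowth.peak_pos (h : IsGrowth Φ) (α : ℝ) (z : ℍ) : 0 < peak α Φ z :=
  h.inv_pos (one_div_im_rpow_pos _ z)

lemma IsGrowth.map_peak (h : IsGrowth Φ) (α : ℝ) (z : ℍ) : Φ (peak α Φ z) = 1 / z.im ^ (2 + α) :=
  h.map_inv (one_div_im_rpow_pos _ z).le

lemma luxNorm_le_ofReal {r : ℝ} (hr : 0 < r)
    (h : ∫⁻ z, ENNReal.ofReal (Φ (‖F z‖ / r)) ∂(V α) ≤ 1) :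
    luxNorm α Φ F ≤ ENNReal.ofReal r := iInf₂_le r ⟨hr, h⟩

lemma IsGrowth.lintegral_div_le_one_of_luxNorm_lt (h : IsGrowth Φ) {R : ℝ}
    (hR : luxNorm α Φ F < ENNReal.ofReal R) :
    ∫⁻ z, ENNReal.ofReal (Φ (‖F z‖ / R)) ∂(V α) ≤ 1 := by
  simp only [luxNorm, iInf_lt_iff] at hR
  obtain ⟨r, ⟨hr0, hr⟩, hrR⟩ := hR
  have hrR := (ENNReal.ofReal_lt_ofReal_iff_of_nonneg hr0.le).1 hrR
  refine le_trans (lintegral_mono fun z => ENNReal.ofReal_le_ofReal ?_) hr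
  have hR0 : 0 < R := hr0.trans hrR
  exact h.map_le_map (by positivity) (by gcongr)

lemma norm_inv_smul_apply {r : ℝ} (hr : 0 < r) (z : ℍ) :
    ‖((r : ℂ)⁻¹ • F) z‖ = ‖F z‖ / r := by
  rw [Pi.smul_apply, norm_smul, norm_inv, Complex.norm_of_nonneg hr.le, inv_mul_eq_div]

namespace IsRegularGrowth

lemma exists_norm_le_mul_peak (h : IsRegularGrowth p Φ) (α : ℝ) :
    ∃ L, 1 ≤ L ∧ ∀ F : ℍ → ℂ, MDifferentiable 𝓘(ℂ) 𝓘(ℂ) F →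
      ∫⁻ z, ENNReal.ofReal (Φ ‖F z‖) ∂(V α) ≤ 1 → ∀ z, ‖F z‖ ≤ L * peak α Φ z := by
  obtain ⟨C, hC0, hC⟩ := h.exists_rpow_mul_map_norm_le α
  obtain ⟨L, hL, hL'⟩ := h.exists_le_mul_of_map_le C
  refine ⟨L, hL, fun F hF hF1 z => hL' _ _ (h.peak_pos α z) ?_⟩
  have := z.im_pos
  have hle : z.im ^ (2 + α) * Φ ‖F z‖ ≤ C := by
    rw [← ENNReal.ofReal_le_ofReal_iff hC0.le]
    calc _ ≤ _ := hC F hF z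
      _ ≤ ENNReal.ofReal C * 1 := by gcongr; exact (setLIntegral_le_lintegral _ _).trans hF1
      _ = _ := mul_one _
  rwa [h.map_peak, mul_one_div, le_div_iff₀' (by positivity)]

lemma exists_norm_le_luxNorm_mul_peak (h : IsRegularGrowth p Φ) (α : ℝ) :
    ∃ L, ∀ F ∈ bergmanOrlicz α Φ, ∀ z, ‖F z‖ ≤ (luxNorm α Φ F).toReal * (L * peak α Φ z) := by
  obtain ⟨L, hL, hL'⟩ := h.exists_norm_le_mul_peak α
  refine ⟨L, fun F hF z => ?_⟩
  have hT : 0 < L * peak α Φ z := mul_pos (one_pos.trans_le hL) (h.peak_pos α z)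
  rw [← div_le_iff₀ hT]
  refine le_of_forall_gt_imp_ge_of_dense fun R hR => ?_
  have hR0 : 0 < R := ENNReal.toReal_nonneg.trans_lt hR
  have hint := h.lintegral_div_le_one_of_luxNorm_lt
    ((ENNReal.lt_ofReal_iff_toReal_lt hF.2.ne).2 hR)
  simp only [← norm_inv_smul_apply hR0] at hint
  have := hL' _ (hF.1.const_smul _) hint z
  rwa [norm_inv_smul_apply hR0, div_le_comm₀ hR0 hT] at this

lemma luxNorm_toReal_pos (h : IsRegularGrowth p Φ) (hF : F ∈ bergmanOrlicz α Φ) (hF0 : F ≠ 0) :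
    0 < (luxNorm α Φ F).toReal := by
  obtain ⟨L, hL⟩ := h.exists_norm_le_luxNorm_mul_peak α
  refine ENNReal.toReal_nonneg.lt_of_ne' fun h0 => hF0 (funext fun z => ?_)
  simpa [h0] using hL F hF z

end IsRegularGrowth

end LuxNorm

/-! ### The Carleson embedding -/

section Embedding

lemma lintegral_mul_setLIntegral_eq {X Y : Type*} [MeasurableSpace X] [MeasurableSpace Y]
    (μ : Measure X) (ν : Measure Y) [SFinite μ] [SFinite ν] {P : X → Y → Prop}
    (hP : MeasurableSet {q : X × Y | P q.1 q.2}) {θ : X → ℝ≥0∞} {g : Y → ℝ≥0∞}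
    (hθ : Measurable θ) (hg : Measurable g) :
    ∫⁻ x, θ x * ∫⁻ y in {y | P x y}, g y ∂ν ∂μ
      = ∫⁻ y, (∫⁻ x in {x | P x y}, θ x ∂μ) * g y ∂ν := by
  have hmeas : Measurable ({q : X × Y | P q.1 q.2}.indicator fun q => θ q.1 * g q.2) :=
    (by fun_prop : Measurable fun q : X × Y => θ q.1 * g q.2).indicator hP
  calc _ = ∫⁻ x, ∫⁻ y, {q : X × Y | P q.1 q.2}.indicator (fun q => θ q.1 * g q.2) (x, y) ∂ν ∂μ := by
        refine lintegral_congr fun x => ?_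
        rw [← lintegral_const_mul _ hg]
        exact (lintegral_indicator (measurable_prodMk_left hP) _).symm
    _ = ∫⁻ y, ∫⁻ x, {q : X × Y | P q.1 q.2}.indicator (fun q => θ q.1 * g q.2) (x, y) ∂μ ∂ν :=
        lintegral_lintegral_swap hmeas.aemeasurable
    _ = _ := by
        refine lintegral_congr fun y => ?_
        rw [← lintegral_mul_const _ hθ]
        exact lintegral_indicator (measurable_prodMk_right hP) _

variable {Φ₁ Φ₂ Θ : ℝ → ℝ} {p α s : ℝ} {μ : Measure ℍ}

lemma mem_carlesonSquare_ball {x r : ℝ} (hr : 0 ≤ r) {z : ℍ} :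
    z ∈ carlesonSquare (Metric.ball x r) ↔ |z.re - x| < r ∧ z.im < 2 * r := by
  rw [carlesonSquare, mem_ofPred_eq, Real.volume_real_ball hr, Metric.mem_ball, Real.dist_eq]

lemma IsSCarleson.exists_measure_carlesonSquare_ball_le (h : IsSCarleson s Θ μ) :
    ∃ A, 0 < A ∧ ∀ x r, 0 < r →
      μ (carlesonSquare (Metric.ball x r)) ≤ ENNReal.ofReal (A / Θ (1 / (2 * r) ^ s)) := by
  obtain ⟨A, hA0, hA⟩ := h
  refine ⟨A, hA0, fun x r hr => ?_⟩
  have hvol := Real.volume_real_ball (a := x) hr.le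
  rw [← hvol]
  exact hA _ (convex_ball x r).ordConnected Metric.isBounded_ball (by rw [hvol]; positivity)

lemma IsSCarleson.sigmaFinite (h : IsSCarleson s Θ μ) : SigmaFinite μ := by
  obtain ⟨A, -, hA⟩ := h.exists_measure_carlesonSquare_ball_le
  refine ⟨⟨⟨fun n : ℕ => carlesonSquare (Metric.ball 0 (n + 1)), fun _ => trivial,
    fun n => (hA 0 _ (by positivity)).trans_lt ENNReal.ofReal_lt_top, ?_⟩⟩⟩
  refine eq_univ_of_forall fun z => mem_iUnion.2 ?_
  obtain ⟨n, hn⟩ := exists_nat_ge (max |z.re| z.im)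
  obtain ⟨hre, him⟩ := max_le_iff.1 hn
  refine ⟨n, (mem_carlesonSquare_ball (by positivity)).2 ⟨?_, ?_⟩⟩
  · rw [sub_zero]
    linarith
  · linarith [z.im_pos]

lemma measurableSet_setOf_mem_whitneyDisc :
    MeasurableSet {q : ℍ × ℍ | q.2 ∈ whitneyDisc q.1} := by
  have := UpperHalfPlane.continuous_im
  have := UpperHalfPlane.continuous_coe
  exact (isOpen_lt (f := fun q : ℍ × ℍ => dist (q.2 : ℂ) q.1) (g := fun q : ℍ × ℍ => q.1.im / 2)
    (by fun_prop) (by fun_prop)).measurableSet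

lemma setOf_mem_whitneyDisc_subset (w : ℍ) :
    {z | w ∈ whitneyDisc z} ⊆ carlesonSquare (Metric.ball w.re (2 * w.im)) := by
  intro z hz
  have him := im_bounds_of_norm_sub_le (mem_ball_iff_norm.1 hz).le
  have hre := abs_re_sub_re_lt_of_mem_whitneyDisc hz
  rw [abs_sub_comm] at hre
  rw [UpperHalfPlane.coe_im] at him
  have := w.im_pos
  exact (mem_carlesonSquare_ball (by positivity)).2 ⟨by linarith, by linarith⟩

lemma IsCarleson.exists_setLIntegral_map_peak_le (h₁ : IsRegularGrowth p Φ₁)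
    (h₂ : IsDoublingGrowth Φ₂) (hα : -1 < α) (hμ : IsCarleson α (Φ₂ ∘ inv Φ₁) μ) :
    ∃ C, 0 < C ∧ ∀ w, ∫⁻ z in {z | w ∈ whitneyDisc z}, ENNReal.ofReal (Φ₂ (peak α Φ₁ z)) ∂μ
      ≤ ENNReal.ofReal C := by
  obtain ⟨A, hA0, hA⟩ := hμ.exists_measure_carlesonSquare_ball_le
  obtain ⟨L, hL1, hL⟩ := h₁.exists_inv_mul_le (K := 6 ^ (2 + α)) (by positivity)
  obtain ⟨E, hE0, hE⟩ := h₂.exists_map_mul_le (zero_le_one.trans hL1)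
  refine ⟨E * A, by positivity, fun w => ?_⟩
  have := w.im_pos
  have hu : 0 < 1 / (2 * (2 * w.im)) ^ (2 + α) := by positivity
  set m := Φ₂ (inv Φ₁ (1 / (2 * (2 * w.im)) ^ (2 + α)))
  have hm0 : 0 < m := h₂.map_pos (h₁.inv_pos hu)
  have hS : MeasurableSet {z | w ∈ whitneyDisc z} :=
    measurable_prodMk_right measurableSet_setOf_mem_whitneyDisc
  have hpeak {z : ℍ} (hz : w ∈ whitneyDisc z) : Φ₂ (peak α Φ₁ z) ≤ E * m := by
    have him : w.im ≤ 3 / 2 * z.im := (im_bounds_of_norm_sub_le (mem_ball_iff_norm.1 hz).le).2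
    have hz0 := z.im_pos
    have hinv : peak α Φ₁ z ≤ L * inv Φ₁ (1 / (2 * (2 * w.im)) ^ (2 + α)) := by
      refine (h₁.inv_monotoneOn (one_div_im_rpow_pos _ z).le ?_ ?_).trans (hL _ hu)
      · exact mem_Ici.2 (by positivity)
      · rw [mul_one_div, div_le_div_iff₀ (by positivity) (by positivity), one_mul,
          ← Real.mul_rpow (by norm_num) hz0.le]
        exact Real.rpow_le_rpow (by positivity) (by linarith) (by linarith)
    exact (h₂.map_le_map (h₁.peak_pos α z).le hinv).trans (hE _ (h₁.inv_mem hu.le))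
  calc _ ≤ ∫⁻ _ in {z | w ∈ whitneyDisc z}, ENNReal.ofReal (E * m) ∂μ :=
        setLIntegral_mono' hS fun z hz => ENNReal.ofReal_le_ofReal (hpeak hz)
    _ = ENNReal.ofReal (E * m) * μ {z | w ∈ whitneyDisc z} := setLIntegral_const _ _
    _ ≤ ENNReal.ofReal (E * m) * ENNReal.ofReal (A / m) := by
        gcongr
        exact (measure_mono (setOf_mem_whitneyDisc_subset w)).trans (hA w.re _ (by positivity))
    _ = ENNReal.ofReal (E * A) := by
        rw [← ENNReal.ofReal_mul (by positivity)]
        congr 1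
        field_simp

lemma IsDoublingGrowth.exists_map_mul_map_le (h₁ : IsDoublingGrowth Φ₁) (h₂ : IsDoublingGrowth Φ₂)
    (hmono : MonotoneOn (fun t => Φ₂ t / Φ₁ t) (Ioi 0)) {L : ℝ} (hL : 1 ≤ L) :
    ∃ D, 0 < D ∧ ∀ s t, 0 < s → 0 ≤ t → t ≤ L * s → Φ₂ t * Φ₁ s ≤ D * Φ₂ s * Φ₁ t := by
  obtain ⟨D, hD0, hD⟩ := h₂.exists_map_mul_le (zero_le_one.trans hL)
  refine ⟨D, hD0, fun s t hs ht hts => ?_⟩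
  rcases ht.eq_or_lt with rfl | ht
  · simp [h₁.map_zero, h₂.map_zero]
  have hLs : 0 < L * s := ht.trans_le hts
  have hquot := hmono (mem_Ioi.2 ht) (mem_Ioi.2 hLs) hts
  simp only [div_le_div_iff₀ (h₁.map_pos ht) (h₁.map_pos hLs)] at hquot
  calc Φ₂ t * Φ₁ s ≤ Φ₂ t * Φ₁ (L * s) := by
        have := h₂.map_nonneg ht.le
        gcongr
        exact h₁.map_le_map hs.le (le_mul_of_one_le_left hs.le hL)
    _ ≤ Φ₂ (L * s) * Φ₁ t := hquot
    _ ≤ D * Φ₂ s * Φ₁ t := by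
        have := h₁.map_nonneg ht.le
        gcongr
        exact hD s hs.le

lemma IsRegularGrowth.exists_map_norm_le_map_peak_mul (h₁ : IsRegularGrowth p Φ₁)
    (h₂ : IsDoublingGrowth Φ₂) (hmono : MonotoneOn (fun t => Φ₂ t / Φ₁ t) (Ioi 0)) (α : ℝ) :
    ∃ C, 0 < C ∧ ∀ F : ℍ → ℂ, MDifferentiable 𝓘(ℂ) 𝓘(ℂ) F →
      ∫⁻ z, ENNReal.ofReal (Φ₁ ‖F z‖) ∂(V α) ≤ 1 → ∀ z, ENNReal.ofReal (Φ₂ ‖F z‖)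
        ≤ ENNReal.ofReal C * (ENNReal.ofReal (Φ₂ (peak α Φ₁ z)) *
          ∫⁻ w in whitneyDisc z, ENNReal.ofReal (Φ₁ ‖F w‖) ∂(V α)) := by
  obtain ⟨L, hL1, hL⟩ := h₁.exists_norm_le_mul_peak α
  obtain ⟨D, hD0, hD⟩ := h₁.exists_map_mul_map_le h₂ hmono hL1
  obtain ⟨C, hC0, hC⟩ := h₁.exists_rpow_mul_map_norm_le α
  refine ⟨D * C, by positivity, fun F hF hF1 z => ?_⟩
  have := z.im_pos
  have hpk := h₂.map_nonneg (h₁.peak_pos α z).le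
  have hle := hD _ _ (h₁.peak_pos α z) (norm_nonneg (F z)) (hL F hF hF1 z)
  rw [h₁.map_peak, mul_one_div, div_le_iff₀ (by positivity)] at hle
  calc ENNReal.ofReal (Φ₂ ‖F z‖)
      ≤ ENNReal.ofReal (D * Φ₂ (peak α Φ₁ z) * (z.im ^ (2 + α) * Φ₁ ‖F z‖)) :=
        ENNReal.ofReal_le_ofReal (hle.trans_eq (by ring))
    _ ≤ ENNReal.ofReal D * ENNReal.ofReal (Φ₂ (peak α Φ₁ z)) *
          (ENNReal.ofReal C * ∫⁻ w in whitneyDisc z, ENNReal.ofReal (Φ₁ ‖F w‖) ∂(V α)) := by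
        rw [ENNReal.ofReal_mul (by positivity), ENNReal.ofReal_mul hD0.le]
        gcongr
        exact hC F hF z
    _ = _ := by
        rw [ENNReal.ofReal_mul hD0.le]
        ring

lemma IsGrowth.measurable_map_peak (h₁ : IsGrowth Φ₁) (h₂ : IsGrowth Φ₂) (α : ℝ) :
    Measurable fun z => Φ₂ (peak α Φ₁ z) := by
  have him : Measurable UpperHalfPlane.im := UpperHalfPlane.continuous_im.measurable
  exact h₂.measurable_comp (h₁.measurable_inv_comp (by fun_prop)
    fun z => (one_div_im_rpow_pos _ z).le) fun z => (h₁.peak_pos α z).le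

lemma IsCarleson.exists_lintegral_le_of_lintegral_le_one (h₁ : IsRegularGrowth p Φ₁)
    (h₂ : IsDoublingGrowth Φ₂) (hα : -1 < α)
    (hmono : MonotoneOn (fun t => Φ₂ t / Φ₁ t) (Ioi 0)) (hμ : IsCarleson α (Φ₂ ∘ inv Φ₁) μ) :
    ∃ C, 0 < C ∧ ∀ F : ℍ → ℂ, MDifferentiable 𝓘(ℂ) 𝓘(ℂ) F →
      ∫⁻ z, ENNReal.ofReal (Φ₁ ‖F z‖) ∂(V α) ≤ 1 →
      ∫⁻ z, ENNReal.ofReal (Φ₂ ‖F z‖) ∂μ ≤ ENNReal.ofReal C := by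
  have : SigmaFinite μ := IsSCarleson.sigmaFinite hμ
  have : SFinite (V α) := by unfold V; infer_instance
  obtain ⟨C, hC0, hC⟩ := h₁.exists_map_norm_le_map_peak_mul h₂ hmono α
  obtain ⟨E, hE0, hE⟩ := hμ.exists_setLIntegral_map_peak_le h₁ h₂ hα
  refine ⟨C * E, by positivity, fun F hF hF1 => ?_⟩
  set g : ℍ → ℝ≥0∞ := fun w => ENNReal.ofReal (Φ₁ ‖F w‖)
  set θ : ℍ → ℝ≥0∞ := fun z => ENNReal.ofReal (Φ₂ (peak α Φ₁ z))
  have hg : Measurable g :=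
    (h₁.measurable_comp hF.continuous.measurable.norm fun _ => norm_nonneg _).ennreal_ofReal
  have hθ : Measurable θ := (h₁.measurable_map_peak h₂.toIsGrowth α).ennreal_ofReal
  calc ∫⁻ z, ENNReal.ofReal (Φ₂ ‖F z‖) ∂μ
      ≤ ENNReal.ofReal C * ∫⁻ z, θ z * ∫⁻ w in whitneyDisc z, g w ∂(V α) ∂μ := by
        rw [← lintegral_const_mul' _ _ ENNReal.ofReal_ne_top]
        exact lintegral_mono (hC F hF hF1)
    _ = ENNReal.ofReal C * ∫⁻ w, (∫⁻ z in {z | w ∈ whitneyDisc z}, θ z ∂μ) * g w ∂(V α) := by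
        congr 1
        exact lintegral_mul_setLIntegral_eq μ (V α) measurableSet_setOf_mem_whitneyDisc hθ hg
    _ ≤ ENNReal.ofReal C * ∫⁻ w, ENNReal.ofReal E * g w ∂(V α) := by
        gcongr with w
        exact hE w
    _ ≤ ENNReal.ofReal C * (ENNReal.ofReal E * 1) := by
        rw [lintegral_const_mul' _ _ ENNReal.ofReal_ne_top]
        gcongr
    _ = ENNReal.ofReal (C * E) := by rw [mul_one, ENNReal.ofReal_mul hC0.le]

theorem IsCarleson.exists_lintegral_div_luxNorm_le (h₁ : IsRegularGrowth p Φ₁)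
    (h₂ : IsDoublingGrowth Φ₂) (hα : -1 < α)
    (hmono : MonotoneOn (fun t => Φ₂ t / Φ₁ t) (Ioi 0)) (hμ : IsCarleson α (Φ₂ ∘ inv Φ₁) μ) :
    ∃ C, 0 < C ∧ ∀ F ∈ bergmanOrlicz α Φ₁, F ≠ 0 →
      ∫⁻ z : ℍ, ENNReal.ofReal (Φ₂ (‖F z‖ / (luxNorm α Φ₁ F).toReal)) ∂μ ≤ ENNReal.ofReal C := by
  obtain ⟨C, hC0, hC⟩ := hμ.exists_lintegral_le_of_lintegral_le_one h₁ h₂ hα hmono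
  obtain ⟨D, hD0, hD⟩ := h₂.exists_map_mul_le zero_le_two
  refine ⟨D * C, by positivity, fun F hF hF0 => ?_⟩
  have hN := h₁.luxNorm_toReal_pos hF hF0
  set N := (luxNorm α Φ₁ F).toReal
  have hint : ∫⁻ z, ENNReal.ofReal (Φ₁ (‖F z‖ / (2 * N))) ∂(V α) ≤ 1 :=
    h₁.lintegral_div_le_one_of_luxNorm_lt
      ((ENNReal.lt_ofReal_iff_toReal_lt hF.2.ne).2 (lt_two_mul_self hN))
  simp only [← norm_inv_smul_apply (mul_pos two_pos hN)] at hint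
  have hhalf := hC _ (hF.1.const_smul _) hint
  simp only [norm_inv_smul_apply (mul_pos two_pos hN)] at hhalf
  calc ∫⁻ z : ℍ, ENNReal.ofReal (Φ₂ (‖F z‖ / N)) ∂μ
      ≤ ∫⁻ z : ℍ, ENNReal.ofReal D * ENNReal.ofReal (Φ₂ (‖F z‖ / (2 * N))) ∂μ := by
        refine lintegral_mono fun z => ?_
        rw [← ENNReal.ofReal_mul hD0.le, ← mul_div_mul_left _ N two_ne_zero, mul_div_assoc]
        exact ENNReal.ofReal_le_ofReal (hD _ (by positivity))
    _ ≤ ENNReal.ofReal (D * C) := by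
        rw [lintegral_const_mul' _ _ ENNReal.ofReal_ne_top, ENNReal.ofReal_mul hD0.le]
        gcongr

end Embedding

/-! ### Test functions -/

section Kernel

/-- The normalized kernel `y / |w - z̄|`, where `y = Im z`, whose powers are the moduli of the test
functions. -/
noncomputable def kernel (z w : ℍ) : ℝ := z.im / ‖(w : ℂ) - star (z : ℂ)‖

lemma abs_re_sub_re_le_norm_sub_star (z w : ℍ) : |w.re - z.re| ≤ ‖(w : ℂ) - star (z : ℂ)‖ := by
  simpa using Complex.abs_re_le_norm ((w : ℂ) - star (z : ℂ))

lemma im_add_im_le_norm_sub_star (z w : ℍ) : w.im + z.im ≤ ‖(w : ℂ) - star (z : ℂ)‖ := by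
  simpa using Complex.im_le_norm ((w : ℂ) - star (z : ℂ))

lemma norm_sub_star_pos (z w : ℍ) : 0 < ‖(w : ℂ) - star (z : ℂ)‖ :=
  (add_pos w.im_pos z.im_pos).trans_le (im_add_im_le_norm_sub_star z w)

lemma kernel_pos (z w : ℍ) : 0 < kernel z w := div_pos z.im_pos (norm_sub_star_pos z w)

lemma kernel_le_one (z w : ℍ) : kernel z w ≤ 1 := by
  rw [kernel, div_le_one (norm_sub_star_pos z w)]
  linarith [im_add_im_le_norm_sub_star z w, w.im_pos]

lemma exists_mem_carlesonSquare_ball_and_kernel_le (z w : ℍ) :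
    ∃ n : ℕ, w ∈ carlesonSquare (Metric.ball z.re (2 ^ (n + 1) * z.im)) ∧
      kernel z w ≤ (2 ^ n)⁻¹ := by
  have hy := z.im_pos
  obtain ⟨n, hn, hn'⟩ := exists_nat_pow_near
    ((one_le_inv₀ (kernel_pos z w)).2 (kernel_le_one z w)) one_lt_two
  refine ⟨n, (mem_carlesonSquare_ball (by positivity)).2 ?_,
    (le_inv_comm₀ (kernel_pos z w) (by positivity)).2 hn⟩
  rw [kernel, inv_div, div_lt_iff₀ hy] at hn'
  have hre := abs_re_sub_re_le_norm_sub_star z w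
  have him := im_add_im_le_norm_sub_star z w
  exact ⟨by linarith, by linarith [w.im_pos]⟩

variable {α : ℝ}

lemma lintegral_rpow_Ioo {r : ℝ} (hα : -1 < α) (hr : 0 ≤ r) :
    ∫⁻ v in Ioo 0 r, ENNReal.ofReal (v ^ α) = ENNReal.ofReal (r ^ (α + 1) / (α + 1)) := by
  rw [← ofReal_integral_eq_lintegral_ofReal, ← integral_Ioc_eq_integral_Ioo,
    ← intervalIntegral.integral_of_le hr, integral_rpow (Or.inl hα),
    Real.zero_rpow (by linarith), sub_zero]
  · have := intervalIntegral.intervalIntegrable_rpow' (a := 0) (b := r) hα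
    rw [intervalIntegrable_iff_integrableOn_Ioc_of_le hr] at this
    exact this.mono_set Ioo_subset_Ioc_self
  · exact (ae_restrict_mem measurableSet_Ioo).mono fun v hv => Real.rpow_nonneg hv.1.le _

lemma measurableSet_carlesonSquare {I : Set ℝ} (hI : MeasurableSet I) :
    MeasurableSet (carlesonSquare I) :=
  (UpperHalfPlane.continuous_re.measurable hI).inter
    (measurableSet_lt UpperHalfPlane.continuous_im.measurable measurable_const)

lemma V_carlesonSquare (hα : -1 < α) {I : Set ℝ} (hI : MeasurableSet I) :
    V α (carlesonSquare I)
      = volume I * ENNReal.ofReal (volume.real I ^ (α + 1) / (α + 1)) := by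
  set J := Ioo 0 (volume.real I)
  have hpre : carlesonSquare I =
      UpperHalfPlane.coe ⁻¹' (Complex.measurableEquivRealProd ⁻¹' (I ×ˢ J)) := by
    ext w
    exact and_congr_right fun _ => ⟨fun h => ⟨w.im_pos, h⟩, fun h => h.2⟩
  calc V α (carlesonSquare I)
      = ∫⁻ w in Complex.measurableEquivRealProd ⁻¹' (I ×ˢ J), ENNReal.ofReal (w.im ^ α) * 1 := by
        rw [← setLIntegral_one, hpre]
        exact setLIntegral_V_preimage_coe α
          (Complex.measurableEquivRealProd.measurable (hI.prod measurableSet_Ioo))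
          (fun w hw => hw.2.1) fun _ => 1
    _ = ∫⁻ q in I ×ˢ J, ENNReal.ofReal (q.2 ^ α) := by
        simp only [mul_one]
        exact Complex.volume_preserving_equiv_real_prod.setLIntegral_comp_preimage_emb
          Complex.measurableEquivRealProd.measurableEmbedding
          (fun q : ℝ × ℝ => ENNReal.ofReal (q.2 ^ α)) (I ×ˢ J)
    _ = ∫⁻ _ in I, ∫⁻ v in J, ENNReal.ofReal (v ^ α) := by
        rw [Measure.volume_eq_prod, ← Measure.prod_restrict, lintegral_prod _ (by fun_prop)]
    _ = _ := by
        rw [lintegral_rpow_Ioo hα measureReal_nonneg, setLIntegral_const, mul_comm]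

lemma V_carlesonSquare_ball (hα : -1 < α) (x : ℝ) {r : ℝ} (hr : 0 < r) :
    V α (carlesonSquare (Metric.ball x r)) = ENNReal.ofReal ((2 * r) ^ (2 + α) / (α + 1)) := by
  rw [V_carlesonSquare hα measurableSet_ball, Real.volume_real_ball hr.le, Real.volume_ball,
    ← ENNReal.ofReal_mul (by positivity), show 2 + α = 1 + (α + 1) by ring,
    Real.rpow_add (by positivity) 1, Real.rpow_one, mul_div_assoc]

lemma kernel_rpow_le_tsum_indicator {β : ℝ} (hβ : 0 ≤ β) (z w : ℍ) :
    ENNReal.ofReal (kernel z w ^ β) ≤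
      ∑' n : ℕ, (carlesonSquare (Metric.ball z.re (2 ^ (n + 1) * z.im))).indicator
        (fun _ => ENNReal.ofReal ((2 ^ n)⁻¹ ^ β)) w := by
  obtain ⟨n, hmem, hle⟩ := exists_mem_carlesonSquare_ball_and_kernel_le z w
  refine le_trans ?_ (ENNReal.le_tsum n)
  rw [indicator_of_mem hmem]
  exact ENNReal.ofReal_le_ofReal (Real.rpow_le_rpow (kernel_pos z w).le hle hβ)

lemma exists_lintegral_kernel_rpow_le (hα : -1 < α) {β : ℝ} (hβ : 2 + α < β) :
    ∃ C, 0 < C ∧ ∀ z, ∫⁻ w, ENNReal.ofReal (kernel z w ^ β) ∂(V α)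
      ≤ ENNReal.ofReal (C * z.im ^ (2 + α)) := by
  set r : ℝ := 2 ^ (2 + α - β) with hr
  have hr0 : 0 < r := by positivity
  have hr1 : r < 1 := Real.rpow_lt_one_of_one_lt_of_neg one_lt_two (by linarith)
  have hα1 : 0 < α + 1 := by linarith
  refine ⟨4 ^ (2 + α) / (α + 1) * (1 - r)⁻¹,
    mul_pos (by positivity) (inv_pos.2 (sub_pos.2 hr1)), fun z => ?_⟩
  have hy := z.im_pos
  set Q : ℕ → Set ℍ := fun n => carlesonSquare (Metric.ball z.re (2 ^ (n + 1) * z.im))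
  have hQ (n : ℕ) : MeasurableSet (Q n) := measurableSet_carlesonSquare measurableSet_ball
  have hterm (n : ℕ) : ENNReal.ofReal ((2 ^ n)⁻¹ ^ β) * V α (Q n)
      = ENNReal.ofReal (4 ^ (2 + α) / (α + 1) * z.im ^ (2 + α) * r ^ n) := by
    rw [V_carlesonSquare_ball hα _ (by positivity), ← ENNReal.ofReal_mul (by positivity),
      show (2 : ℝ) * (2 ^ (n + 1) * z.im) = 4 * 2 ^ n * z.im by ring, hr,
      Real.mul_rpow (by positivity) hy.le, Real.mul_rpow (by positivity) (by positivity),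
      Real.rpow_pow_comm two_pos.le, Real.rpow_sub (by positivity), Real.inv_rpow (by positivity)]
    congr 1
    field_simp
  calc _ ≤ ∫⁻ w, ∑' n, (Q n).indicator (fun _ => ENNReal.ofReal ((2 ^ n)⁻¹ ^ β)) w ∂(V α) :=
        lintegral_mono (kernel_rpow_le_tsum_indicator (by linarith) z)
    _ = ∑' n, ENNReal.ofReal (4 ^ (2 + α) / (α + 1) * z.im ^ (2 + α) * r ^ n) := by
        rw [lintegral_tsum fun n => (measurable_const.indicator (hQ n)).aemeasurable]
        simp only [lintegral_indicator_const (hQ _), hterm]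
    _ = ENNReal.ofReal (∑' n, 4 ^ (2 + α) / (α + 1) * z.im ^ (2 + α) * r ^ n) :=
        (ENNReal.ofReal_tsum_of_nonneg (fun n => by positivity)
          ((summable_geometric_of_lt_one hr0.le hr1).mul_left _)).symm
    _ = _ := by
        rw [tsum_mul_left, tsum_geometric_of_lt_one hr0.le hr1, mul_right_comm]

lemma exists_mdifferentiable_norm_eq_kernel_rpow (z : ℍ) (β : ℝ) :
    ∃ F : ℍ → ℂ, MDifferentiable 𝓘(ℂ) 𝓘(ℂ) F ∧ ∀ w, ‖F w‖ = kernel z w ^ β := by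
  have hy := z.im_pos
  set f : ℂ → ℂ := fun w => (-Complex.I * (w - star (z : ℂ)) / z.im) ^ ((-β : ℝ) : ℂ) with hf
  refine ⟨fun w => f w, UpperHalfPlane.mdifferentiable_iff.2 ?_, fun w => ?_⟩
  · have hfd : DifferentiableOn ℂ f {w | 0 < w.im} := by
      intro w (hw : 0 < w.im)
      refine (DifferentiableAt.cpow (by fun_prop) (by fun_prop) (Or.inl ?_)).differentiableWithinAt
      simp only [RCLike.star_def, neg_mul, Complex.div_ofReal_re, Complex.neg_re, Complex.mul_re,
        Complex.I_re, Complex.sub_re, Complex.conj_re, UpperHalfPlane.coe_re, zero_mul,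
        Complex.I_im, Complex.sub_im, Complex.conj_im, UpperHalfPlane.coe_im, sub_neg_eq_add,
        one_mul, zero_sub, neg_neg]
      positivity
    refine hfd.congr fun w hw => ?_
    rw [Function.comp_apply, UpperHalfPlane.ofComplex_apply_of_im_pos hw]
  · rw [hf, Complex.norm_cpow_real, norm_div, norm_mul, norm_neg, Complex.norm_I, one_mul,
      Complex.norm_of_nonneg hy.le, ← inv_div, ← kernel, Real.inv_rpow (kernel_pos z w).le,
      Real.rpow_neg (kernel_pos z w).le, inv_inv]

variable {Φ : ℝ → ℝ} {p β : ℝ}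

lemma IsRegularGrowth.exists_lintegral_map_peak_mul_kernel_rpow_le_one (h : IsRegularGrowth p Φ)
    (hα : -1 < α) (hβ : 2 + α < β * p) :
    ∃ R, 0 < R ∧ ∀ z,
      ∫⁻ w, ENNReal.ofReal (Φ (peak α Φ z * kernel z w ^ β / R)) ∂(V α) ≤ 1 := by
  have hp := h.exponent_pos
  obtain ⟨A, hA0, hA⟩ := h.lowerType
  obtain ⟨C, hC0, hC⟩ := exists_lintegral_kernel_rpow_le hα hβ
  have hβ0 : 0 < β := pos_of_mul_pos_left (by linarith) hp.le
  set R := max 1 (A * C) ^ p⁻¹ with hR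
  have hR1 : 1 ≤ R := Real.one_le_rpow (le_max_left _ _) (inv_nonneg.2 hp.le)
  have hR0 : 0 < R := one_pos.trans_le hR1
  have hRp : A * C ≤ R ^ p := by
    rw [hR, Real.rpow_inv_rpow (by positivity) hp.ne']
    exact le_max_right _ _
  refine ⟨R, hR0, fun z => ?_⟩
  have := z.im_pos
  have hpt (w : ℍ) : Φ (peak α Φ z * kernel z w ^ β / R)
      ≤ A * (R ^ p)⁻¹ * (1 / z.im ^ (2 + α)) * kernel z w ^ (β * p) := by
    have hk := kernel_pos z w
    have hk1 := Real.rpow_le_one hk.le (kernel_le_one z w) hβ0.le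
    have := hA (kernel z w ^ β / R) (by positivity) (div_le_one_of_le₀ (hk1.trans hR1) hR0.le) _
      (h.peak_pos α z)
    rw [h.map_peak, Real.div_rpow (by positivity) hR0.le, ← Real.rpow_mul hk.le,
      ← mul_div_assoc] at this
    exact this.trans_eq (by ring)
  calc _ ≤ ∫⁻ w, ENNReal.ofReal (A * (R ^ p)⁻¹ * (1 / z.im ^ (2 + α))) *
          ENNReal.ofReal (kernel z w ^ (β * p)) ∂(V α) := by
        refine lintegral_mono fun w => ?_
        rw [← ENNReal.ofReal_mul (by positivity)]
        exact ENNReal.ofReal_le_ofReal (hpt w)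
    _ ≤ ENNReal.ofReal (A * (R ^ p)⁻¹ * (1 / z.im ^ (2 + α))) *
          ENNReal.ofReal (C * z.im ^ (2 + α)) := by
        rw [lintegral_const_mul' _ _ ENNReal.ofReal_ne_top]
        gcongr
        exact hC z
    _ = ENNReal.ofReal (A * C / R ^ p) := by
        rw [← ENNReal.ofReal_mul (by positivity)]
        congr 1
        field_simp
    _ ≤ 1 := ENNReal.ofReal_le_one.2 (div_le_one_of_le₀ hRp (by positivity))

lemma IsRegularGrowth.exists_test_function (h : IsRegularGrowth p Φ) (hα : -1 < α)
    (hβ : 2 + α < β * p) :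
    ∃ R, 0 < R ∧ ∀ z, ∃ F ∈ bergmanOrlicz α Φ, F ≠ 0 ∧ (luxNorm α Φ F).toReal ≤ R ∧
      ∀ w, ‖F w‖ = peak α Φ z * kernel z w ^ β := by
  obtain ⟨R, hR0, hR⟩ := h.exists_lintegral_map_peak_mul_kernel_rpow_le_one hα hβ
  refine ⟨R, hR0, fun z => ?_⟩
  have hT := h.peak_pos α z
  obtain ⟨F, hF, hFn⟩ := exists_mdifferentiable_norm_eq_kernel_rpow z β
  set G := (peak α Φ z : ℂ) • F
  have hG (w : ℍ) : ‖G w‖ = peak α Φ z * kernel z w ^ β := by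
    change ‖(peak α Φ z : ℂ) • F w‖ = _
    rw [norm_smul, Complex.norm_of_nonneg hT.le, hFn]
  have hlux : luxNorm α Φ G ≤ ENNReal.ofReal R :=
    luxNorm_le_ofReal hR0 (by simpa only [hG] using hR z)
  have hG0 : G ≠ 0 := fun h0 => by
    have hpos : 0 < ‖G z‖ := hG z ▸ mul_pos hT (Real.rpow_pos_of_pos (kernel_pos z z) β)
    simp [h0] at hpos
  exact ⟨G, ⟨hF.const_smul _, hlux.trans_lt ENNReal.ofReal_lt_top⟩, hG0,
    ENNReal.toReal_le_of_le_ofReal hR0.le hlux, hG⟩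

end Kernel

/-! ### Necessity of the Carleson condition -/

section Necessity

variable {Φ₁ Φ₂ : ℝ → ℝ} {p α β : ℝ} {μ : Measure ℍ}

lemma kernel_rpow (z w : ℍ) (β : ℝ) :
    kernel z w ^ β = z.im ^ β / ‖(w : ℂ) - star (z : ℂ)‖ ^ β :=
  Real.div_rpow z.im_pos.le (norm_nonneg _) β

lemma exists_im_eq_and_forall_mem_carlesonSquare_le_kernel {I : Set ℝ} (hI : I.OrdConnected)
    (hb : Bornology.IsBounded I) (hI0 : 0 < volume.real I) :
    ∃ z : ℍ, z.im = volume.real I ∧ ∀ w ∈ carlesonSquare I, 1 / 3 ≤ kernel z w := by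
  obtain ⟨x, hx⟩ : I.Nonempty := nonempty_of_measureReal_ne_zero hI0.ne'
  set z : ℍ := ⟨⟨x, volume.real I⟩, hI0⟩
  have hz : z.im = volume.real I := rfl
  refine ⟨z, hz, fun w hw => ?_⟩
  have hre : |w.re - z.re| ≤ z.im := by
    rw [← Real.volume_real_interval]
    exact measureReal_mono (hI.uIcc_subset hx hw.1) hb.measure_lt_top.ne
  have him : w.im < z.im := hw.2
  have hnorm : ‖(w : ℂ) - star (z : ℂ)‖ ≤ |w.re - z.re| + (w.im + z.im) := by
    simpa [abs_of_pos (add_pos w.im_pos z.im_pos)] using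
      Complex.norm_le_abs_re_add_abs_im ((w : ℂ) - star (z : ℂ))
  rw [kernel, le_div_iff₀ (norm_sub_star_pos z w)]
  linarith

lemma isCarleson_of_forall_mul_measure_le_kernel_le (h₁ : IsGrowth Φ₁) (h₂ : IsDoublingGrowth Φ₂)
    {κ C : ℝ} (hκ : 0 < κ) (hC : 0 < C)
    (h : ∀ z, ENNReal.ofReal (Φ₂ (κ * peak α Φ₁ z)) * μ {w | 1 / 3 ≤ kernel z w}
      ≤ ENNReal.ofReal C) : IsCarleson α (Φ₂ ∘ inv Φ₁) μ := by
  obtain ⟨D, hD0, hD⟩ := h₂.exists_map_mul_le (inv_nonneg.2 hκ.le)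
  refine ⟨D * C, by positivity, fun I hI hb hI0 => ?_⟩
  obtain ⟨z, hz, hzI⟩ := exists_im_eq_and_forall_mem_carlesonSquare_le_kernel hI hb hI0
  rw [← hz, Function.comp_apply, ← peak]
  have hT := h₁.peak_pos α z
  have hpos := h₂.map_pos (mul_pos hκ hT)
  calc μ (carlesonSquare I) ≤ μ {w | 1 / 3 ≤ kernel z w} := measure_mono hzI
    _ ≤ ENNReal.ofReal (C / Φ₂ (κ * peak α Φ₁ z)) := by
        rw [ENNReal.ofReal_div_of_pos hpos, ENNReal.le_div_iff_mul_le
          (Or.inl (ENNReal.ofReal_pos.2 hpos).ne') (Or.inl ENNReal.ofReal_ne_top), mul_comm]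
        exact h z
    _ ≤ ENNReal.ofReal (D * C / Φ₂ (peak α Φ₁ z)) := by
        have hdoubling := hD _ (mul_pos hκ hT).le
        rw [inv_mul_cancel_left₀ hκ.ne'] at hdoubling
        refine ENNReal.ofReal_le_ofReal ?_
        rw [div_le_div_iff₀ hpos (h₂.map_pos hT), mul_comm D, mul_assoc]
        gcongr

lemma measurable_kernel (z : ℍ) : Measurable (kernel z) := by
  have : Measurable UpperHalfPlane.coe := UpperHalfPlane.measurable_coe
  unfold kernel
  fun_prop

theorem isCarleson_of_lintegral_map_peak_mul_kernel_rpow_le (h₁ : IsGrowth Φ₁)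
    (h₂ : IsDoublingGrowth Φ₂) (hβ : 0 ≤ β) {C : ℝ} (hC : 0 < C)
    (h : ∀ z, ∫⁻ w, ENNReal.ofReal (Φ₂ (peak α Φ₁ z * kernel z w ^ β)) ∂μ ≤ ENNReal.ofReal C) :
    IsCarleson α (Φ₂ ∘ inv Φ₁) μ := by
  refine isCarleson_of_forall_mul_measure_le_kernel_le h₁ h₂ (κ := (1 / 3) ^ β) (by positivity) hC
    fun z => ?_
  have hT := h₁.peak_pos α z
  calc _ ≤ ENNReal.ofReal (Φ₂ ((1 / 3) ^ β * peak α Φ₁ z)) *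
          μ {w | (1 / 3) ^ β * peak α Φ₁ z ≤ peak α Φ₁ z * kernel z w ^ β} := by
        refine mul_le_mul_right (measure_mono fun w (hw : 1 / 3 ≤ kernel z w) => ?_) _
        rw [mem_ofPred_eq, mul_comm]
        gcongr
    _ ≤ _ := h₂.map_mul_measure_le_lintegral μ
        (((measurable_kernel z).pow_const β).const_mul _)
        (fun w => mul_nonneg hT.le (Real.rpow_nonneg (kernel_pos z w).le β)) (by positivity)
    _ ≤ _ := h z

theorem IsRegularGrowth.exists_lintegral_map_peak_mul_kernel_rpow_le (h₁ : IsRegularGrowth p Φ₁)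
    (h₂ : IsDoublingGrowth Φ₂) (hα : -1 < α) (hβ : 2 + α < β * p) {C : ℝ} (hC : 0 < C)
    (h : ∀ F ∈ bergmanOrlicz α Φ₁, F ≠ 0 →
      ∫⁻ z, ENNReal.ofReal (Φ₂ (‖F z‖ / (luxNorm α Φ₁ F).toReal)) ∂μ ≤ ENNReal.ofReal C) :
    ∃ C, 0 < C ∧ ∀ z, ∫⁻ w, ENNReal.ofReal (Φ₂ (peak α Φ₁ z * kernel z w ^ β)) ∂μ
      ≤ ENNReal.ofReal C := by
  obtain ⟨R, hR0, hR⟩ := h₁.exists_test_function hα hβ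
  obtain ⟨D, hD0, hD⟩ := h₂.exists_map_mul_le hR0.le
  refine ⟨D * C, by positivity, fun z => ?_⟩
  obtain ⟨F, hF, hF0, hFR, hFn⟩ := hR z
  have hN := h₁.luxNorm_toReal_pos hF hF0
  set N := (luxNorm α Φ₁ F).toReal
  have hle (w : ℍ) : ‖F w‖ ≤ R * (‖F w‖ / N) := by
    rw [mul_div_assoc', le_div_iff₀ hN, mul_comm]
    gcongr
  simp only [← hFn]
  calc ∫⁻ w, ENNReal.ofReal (Φ₂ ‖F w‖) ∂μ
      ≤ ∫⁻ w, ENNReal.ofReal D * ENNReal.ofReal (Φ₂ (‖F w‖ / N)) ∂μ := by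
        refine lintegral_mono fun w => ?_
        rw [← ENNReal.ofReal_mul hD0.le]
        exact ENNReal.ofReal_le_ofReal
          ((h₂.map_le_map (norm_nonneg _) (hle w)).trans (hD _ (by positivity)))
    _ ≤ ENNReal.ofReal (D * C) := by
        rw [lintegral_const_mul' _ _ ENNReal.ofReal_ne_top, ENNReal.ofReal_mul hD0.le]
        gcongr
        exact h F hF hF0

theorem IsRegularGrowth.iSup_mul_measure_le (h₁ : IsRegularGrowth p Φ₁) (h₂ : IsGrowth Φ₂)
    {C : ℝ} {F : ℍ → ℂ} (hF : F ∈ bergmanOrlicz α Φ₁)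
    (h : F ≠ 0 →
      ∫⁻ z, ENNReal.ofReal (Φ₂ (‖F z‖ / (luxNorm α Φ₁ F).toReal)) ∂μ ≤ ENNReal.ofReal C) :
    (⨆ (l : ℝ) (_ : 0 < l), ENNReal.ofReal (Φ₂ l) *
      μ {z : ℍ | l * (luxNorm α Φ₁ F).toReal < ‖F z‖}) ≤ ENNReal.ofReal C := by
  refine iSup₂_le fun l hl => ?_
  rcases eq_or_ne F 0 with rfl | hF0
  · have hempty : {z : ℍ | l * (luxNorm α Φ₁ 0).toReal < ‖(0 : ℍ → ℂ) z‖} = ∅ := by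
      refine eq_empty_of_forall_notMem fun z hz => ?_
      rw [mem_ofPred_eq, Pi.zero_apply, norm_zero] at hz
      exact hz.not_ge (by positivity)
    rw [hempty, measure_empty, mul_zero]
    exact zero_le
  · have hN := h₁.luxNorm_toReal_pos hF hF0
    calc _ ≤ ENNReal.ofReal (Φ₂ l) * μ {z | l ≤ ‖F z‖ / (luxNorm α Φ₁ F).toReal} := by
          gcongr with z
          exact fun hz => (le_div_iff₀ hN).2 hz.le
      _ ≤ _ := h₂.map_mul_measure_le_lintegral μ (hF.1.continuous.measurable.norm.div_const _)
          (fun _ => div_nonneg (norm_nonneg _) hN.le) hl.le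
      _ ≤ _ := h hF0

theorem isCarleson_of_iSup_mul_measure_le (h₁ : IsRegularGrowth p Φ₁) (h₂ : IsDoublingGrowth Φ₂)
    (hα : -1 < α) {C : ℝ} (hC : 0 < C)
    (h : ∀ F ∈ bergmanOrlicz α Φ₁,
      (⨆ (l : ℝ) (_ : 0 < l), ENNReal.ofReal (Φ₂ l) *
        μ {z : ℍ | l * (luxNorm α Φ₁ F).toReal < ‖F z‖}) ≤ ENNReal.ofReal C) :
    IsCarleson α (Φ₂ ∘ inv Φ₁) μ := by
  have hp := h₁.exponent_pos
  obtain ⟨β, hβ⟩ := exists_gt ((2 + α) / p)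
  have hβ0 : 0 < β := (div_pos (by linarith) hp).trans hβ
  obtain ⟨R, hR0, hR⟩ := h₁.exists_test_function hα ((div_lt_iff₀ hp).1 hβ)
  refine isCarleson_of_forall_mul_measure_le_kernel_le h₁.toIsGrowth h₂
    (κ := (1 / 3) ^ β / (2 * R)) (by positivity) hC fun z => ?_
  obtain ⟨F, hF, -, hFR, hFn⟩ := hR z
  have hT := h₁.peak_pos α z
  set l := (1 / 3) ^ β / (2 * R) * peak α Φ₁ z with hl
  have hl0 : 0 < l := by positivity
  have hsub : {w | 1 / 3 ≤ kernel z w} ⊆ {w | l * (luxNorm α Φ₁ F).toReal < ‖F w‖} := by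
    intro w (hw : 1 / 3 ≤ kernel z w)
    calc l * (luxNorm α Φ₁ F).toReal ≤ l * R := by gcongr
      _ = peak α Φ₁ z * (1 / 3) ^ β / 2 := by rw [hl]; field_simp
      _ < peak α Φ₁ z * (1 / 3) ^ β := half_lt_self (by positivity)
      _ ≤ peak α Φ₁ z * kernel z w ^ β := by gcongr
      _ = ‖F w‖ := (hFn w).symm
  calc _ ≤ ENNReal.ofReal (Φ₂ l) * μ {w | l * (luxNorm α Φ₁ F).toReal < ‖F w‖} := by gcongr
    _ ≤ _ := le_iSup₂ (f := fun (l : ℝ) (_ : 0 < l) => ENNReal.ofReal (Φ₂ l) *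
      μ {w : ℍ | l * (luxNorm α Φ₁ F).toReal < ‖F w‖}) l hl0
    _ ≤ ENNReal.ofReal C := h F hF

end Necessity

end BergmanOrlicz

theorem theorem2p3_general {α p : ℝ} (hα : -1 < α) {Φ₁ Φ₂ : ℝ → ℝ}
    (h₁ : BergmanOrlicz.IsRegularGrowth p Φ₁) (h₂ : BergmanOrlicz.IsDoublingGrowth Φ₂)
    (μ : Measure ℍ) (hmono : MonotoneOn (fun t => Φ₂ t / Φ₁ t) (Ioi 0)) :
    List.TFAE [
      BergmanOrlicz.IsCarleson α (Φ₂ ∘ BergmanOrlicz.inv Φ₁) μ,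
      ∃ ρ ∈ ({1, p} : Set ℝ), ∃ C : ℝ, 0 < C ∧ ∀ z : ℍ,
        ∫⁻ w : ℍ, ENNReal.ofReal (Φ₂ (BergmanOrlicz.inv Φ₁ (1 / z.im ^ (2 + α)) *
          (z.im ^ ((4 + 2 * α) / ρ) / ‖(w : ℂ) - star (z : ℂ)‖ ^ ((4 + 2 * α) / ρ)))) ∂μ
          ≤ ENNReal.ofReal C,
      ∃ C : ℝ, 0 < C ∧ ∀ F ∈ BergmanOrlicz.bergmanOrlicz α Φ₁, F ≠ 0 →
        ∫⁻ z : ℍ, ENNReal.ofReal (Φ₂ (‖F z‖ / (BergmanOrlicz.luxNorm α Φ₁ F).toReal)) ∂μ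
          ≤ ENNReal.ofReal C,
      ∃ C : ℝ, 0 < C ∧ ∀ F ∈ BergmanOrlicz.bergmanOrlicz α Φ₁,
        (⨆ (l : ℝ) (_ : 0 < l), ENNReal.ofReal (Φ₂ l) *
          μ {z : ℍ | l * (BergmanOrlicz.luxNorm α Φ₁ F).toReal < ‖F z‖})
          ≤ ENNReal.ofReal C] := by
  have hp := h₁.exponent_pos
  simp only [← BergmanOrlicz.kernel_rpow]
  tfae_have 1 → 3 := fun h => h.exists_lintegral_div_luxNorm_le h₁ h₂ hα hmono
  tfae_have 3 → 2 := fun ⟨C, hC, h⟩ =>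
    ⟨p, Or.inr rfl, h₁.exists_lintegral_map_peak_mul_kernel_rpow_le h₂ hα
      (by rw [div_mul_cancel₀ _ hp.ne']; linarith) hC h⟩
  tfae_have 2 → 1 := by
    rintro ⟨ρ, hρ, C, hC, h⟩
    have hρ0 : 0 < ρ := by rcases hρ with rfl | rfl <;> [exact one_pos; exact hp]
    exact BergmanOrlicz.isCarleson_of_lintegral_map_peak_mul_kernel_rpow_le h₁.toIsGrowth h₂
      (div_nonneg (by linarith) hρ0.le) hC h
  tfae_have 3 → 4 := fun ⟨C, hC, h⟩ =>
    ⟨C, hC, fun F hF => h₁.iSup_mul_measure_le h₂.toIsGrowth hF (h F hF)⟩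
  tfae_have 4 → 1 := fun ⟨C, hC, h⟩ =>
    BergmanOrlicz.isCarleson_of_iSup_mul_measure_le h₁ h₂ hα hC h
  tfae_finish

theorem theorem2p3 (α : ℝ) (hα : -1 < α) (Φ₁ Φ₂ : ℝ → ℝ)
    (hΦ₁ : BergmanOrlicz.ClassL Φ₁ ∨ BergmanOrlicz.ClassU Φ₁)
    (hΦ₂ : BergmanOrlicz.ClassL Φ₂ ∨ BergmanOrlicz.ClassU Φ₂)
    (μ : Measure ℍ)
    (hmono : MonotoneOn (fun t => Φ₂ t / Φ₁ t) (Ioi 0)) :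
    List.TFAE [
      BergmanOrlicz.IsCarleson α (Φ₂ ∘ BergmanOrlicz.inv Φ₁) μ,
      ∃ ρ ∈ ({1, BergmanOrlicz.lowerIndex Φ₁} : Set ℝ), ∃ C : ℝ, 0 < C ∧ ∀ z : ℍ,
        ∫⁻ w : ℍ, ENNReal.ofReal (Φ₂ (BergmanOrlicz.inv Φ₁ (1 / z.im ^ (2 + α)) *
          (z.im ^ ((4 + 2 * α) / ρ) / ‖(w : ℂ) - star (z : ℂ)‖ ^ ((4 + 2 * α) / ρ)))) ∂μ
          ≤ ENNReal.ofReal C,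
      ∃ C : ℝ, 0 < C ∧ ∀ F ∈ BergmanOrlicz.bergmanOrlicz α Φ₁, F ≠ 0 →
        ∫⁻ z : ℍ, ENNReal.ofReal (Φ₂ (‖F z‖ / (BergmanOrlicz.luxNorm α Φ₁ F).toReal)) ∂μ
          ≤ ENNReal.ofReal C,
      ∃ C : ℝ, 0 < C ∧ ∀ F ∈ BergmanOrlicz.bergmanOrlicz α Φ₁,
        (⨆ (l : ℝ) (_ : 0 < l), ENNReal.ofReal (Φ₂ l) *
          μ {z : ℍ | l * (BergmanOrlicz.luxNorm α Φ₁ F).toReal < ‖F z‖})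
          ≤ ENNReal.ofReal C] := by
  exact theorem2p3_general hα
    (BergmanOrlicz.isRegularGrowth_lowerIndex_of_classL_or_classU hΦ₁)
    (BergmanOrlicz.isRegularGrowth_lowerIndex_of_classL_or_classU hΦ₂).toIsDoublingGrowth μ hmono
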